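/- Let $m\ge 2$ be an integer and, for $k=1,\dots,m$, let $H_k$ be a complex Hilbert space and $\mathcal T_k=(T_k(t))_{t\ge 0}$ a family of bounded linear operators on $H_k$ with $T_k(0)=I$ and $T_k(s+t)=T_k(s)T_k(t)$ for all $s,t\ge 0$ (a semigroup), such that $t\mapsto T_k(t)h$ is norm continuous on $(0,\infty)$ for every $h\in H_k$, and such that $T_k(t)\ne 0$ for some $t>0$. Let $\otimes_{k=1}^m H_k$ be the Hilbert space tensor product, i.e. the completion of the algebraic tensor product under the inner product determined by $\langle \otimes_k f_k,\otimes_k g_k\rangle=\prod_k\langle f_k,g_k\rangle$, and let $\otimes_{k=1}^m\mathcal T_k=(\otimes_{k=1}^m T_k(t))_{t\ge0}$ be the semigroup of bounded operators on it determined by $(\otimes_k T_k(t))(\otimes_k f_k)=\otimes_k T_k(t)f_k$. For a semigroup $\mathcal T=(T(t))_{t\ge0}$ on a Hilbert space $H$ and $d\in\mathbb R$, write $e_d\mathcal T=(e^{dt}T(t))_{t\ge0}$. Call $\mathcal T$ a contraction semigroup if $\|T(t)\|\le1$ for all $t\ge0$, and a quasi-contraction semigroup if $e_a\mathcal T$ is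 a contraction semigroup for some $a\in\mathbb R$. Semigroups $\mathcal T$ and $\mathcal S$ on $H$ are similar if there is a boundedly invertible operator $R$ on $H$ with $T(t)=RS(t)R^{-1}$ for all $t\ge0$. Then: (i) $\otimes_{k=1}^m\mathcal T_k$ is similar to a quasi-contraction semigroup if and only if every $\mathcal T_k$ is similar to a quasi-contraction semigroup. (ii) $\otimes_{k=1}^m\mathcal T_k$ is similar to a contraction semigroup if and only if there are $d_1,\dots,d_m\in\mathbb R$ with $\sum_{k=1}^m d_k=0$ such that, for every $k$, the semigroup $e_{d_k}\mathcal T_k$ is similar to a contraction semigroup. -/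

import Mathlib

noncomputable section

open scoped NNReal TensorProduct ComplexOrder

/-! ### The algebraic tensor product with its canonical inner product -/

namespace HilbertTensor

/-- The algebraic tensor product of a finite family of complex inner product spaces. This is a
type synonym for `PiTensorProduct`, which carries no norm from Mathlib, so that it can be given
the canonical inner product `⟪⊙ f k, ⊙ g k⟫ = ∏ k, ⟪f k, g k⟫`. -/
def Alg {ι : Type*} (H : ι → Type*) [∀ k, NormedAddCommGroup (H k)]
    [∀ k, InnerProductSpace ℂ (H k)] : Type _ := ⨂[ℂ] k, H k

section Alg

variable {ι : Type*} {H : ι → Type*} [∀ k, NormedAddCommGroup (H k)]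
  [∀ k, InnerProductSpace ℂ (H k)]

instance : AddCommGroup (Alg H) := inferInstanceAs (AddCommGroup (⨂[ℂ] k, H k))

instance : Module ℂ (Alg H) := inferInstanceAs (Module ℂ (⨂[ℂ] k, H k))

variable (H) in
/-- The elementary tensor `⊙ f k`, as a multilinear map. -/
def algTprod : MultilinearMap ℂ H (Alg H) := PiTensorProduct.tprod ℂ

theorem alg_span : Submodule.span ℂ (Set.range (algTprod H)) = ⊤ :=
  PiTensorProduct.span_tprod_eq_top

theorem alg_conjLinear_ext {φ ψ : Alg H →ₗ⋆[ℂ] ℂ}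
    (h : ∀ f, φ (algTprod H f) = ψ (algTprod H f)) : φ = ψ := by
  ext z
  have hz : z ∈ Submodule.span ℂ (Set.range (algTprod H)) := by rw [alg_span]; trivial
  induction hz using Submodule.span_induction with
  | mem x hx => obtain ⟨f, rfl⟩ := hx; exact h f
  | zero => simp
  | add x y _ _ hx hy => simp [hx, hy]
  | smul c x _ hx => simp [hx]

theorem alg_exists_sum (z : Alg H) : ∃ (n : ℕ) (c : Fin n → ℂ) (f : Fin n → ∀ k, H k),
    z = ∑ j, c j • algTprod H (f j) := by
  have hz : z ∈ Submodule.span ℂ (Set.range (algTprod H)) := by rw [alg_span]; trivial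
  obtain ⟨n, c, g, rfl⟩ := (Submodule.mem_span_set'.1 hz)
  choose f hf using fun j => (g j).2
  exact ⟨n, c, f, by simp [hf]⟩

/-- The algebraic tensor product of operators, `⊙ f k ↦ ⊙ A k (f k)`. -/
def algMap (A : ∀ k, H k →L[ℂ] H k) : Alg H →ₗ[ℂ] Alg H :=
  PiTensorProduct.map fun k => (A k : H k →ₗ[ℂ] H k)

@[simp]
theorem algMap_tprod (A : ∀ k, H k →L[ℂ] H k) (f : ∀ k, H k) :
    algMap A (algTprod H f) = algTprod H fun k => A k (f k) :=
  PiTensorProduct.map_tprod (fun k => (A k : H k →ₗ[ℂ] H k)) f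

variable [Fintype ι]

/-- For fixed `f`, the linear functional `⊙ g k ↦ ∏ k, ⟪f k, g k⟫`. -/
def algFunctional (f : ∀ k, H k) : Alg H →ₗ[ℂ] ℂ :=
  PiTensorProduct.lift
    ((MultilinearMap.mkPiAlgebra ℂ ι ℂ).compLinearMap fun k => innerₛₗ ℂ (f k))

@[simp]
theorem algFunctional_tprod (f g : ∀ k, H k) :
    algFunctional f (algTprod H g) = ∏ k, inner ℂ (f k) (g k) :=
  (PiTensorProduct.lift.tprod (R := ℂ) g).trans (by simp)

/-- For fixed `g`, the conjugate of `algFunctional g` as a conjugate-linear functional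
`⊙ f k ↦ ∏ k, ⟪f k, g k⟫`. -/
def algConjFunctional (g : ∀ k, H k) : Alg H →ₗ⋆[ℂ] ℂ where
  toFun z := starRingEnd ℂ (algFunctional g z)
  map_add' z w := by simp
  map_smul' c z := by simp

theorem algConjFunctional_tprod (f g : ∀ k, H k) :
    algConjFunctional g (algTprod H f) = ∏ k, inner ℂ (f k) (g k) := by
  simp [algConjFunctional, map_prod, inner_conj_symm]

variable (H) in
/-- The canonical sesquilinear form on the algebraic tensor product: `algForm H w z` is linear in
`w`, conjugate-linear in `z`, and `algForm H (⊙ g k) (⊙ f k) = ∏ k, ⟪f k, g k⟫`. -/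
def algForm : Alg H →ₗ[ℂ] Alg H →ₗ⋆[ℂ] ℂ :=
  PiTensorProduct.lift
    { toFun := algConjFunctional
      map_update_add' := by
        intro _ g i x y
        refine alg_conjLinear_ext fun f => ?_
        simp only [algConjFunctional_tprod, LinearMap.add_apply]
        exact ((MultilinearMap.mkPiAlgebra ℂ ι ℂ).compLinearMap
          fun k => innerₛₗ ℂ (f k)).map_update_add g i x y
      map_update_smul' := by
        intro _ g i c x
        refine alg_conjLinear_ext fun f => ?_
        simp only [algConjFunctional_tprod, LinearMap.smul_apply]
        exact ((MultilinearMap.mkPiAlgebra ℂ ι ℂ).compLinearMap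
          fun k => innerₛₗ ℂ (f k)).map_update_smul g i c x }

@[simp]
theorem algForm_tprod (f g : ∀ k, H k) :
    algForm H (algTprod H g) (algTprod H f) = ∏ k, inner ℂ (f k) (g k) := by
  rw [← algConjFunctional_tprod]
  exact LinearMap.congr_fun (PiTensorProduct.lift.tprod (R := ℂ) g) (algTprod H f)

theorem algForm_conj_symm (z w : Alg H) : starRingEnd ℂ (algForm H z w) = algForm H w z := by
  have hz : z ∈ Submodule.span ℂ (Set.range (algTprod H)) := by rw [alg_span]; trivial
  have hw : w ∈ Submodule.span ℂ (Set.range (algTprod H)) := by rw [alg_span]; trivial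
  induction hz using Submodule.span_induction with
  | mem x hx =>
    obtain ⟨f, rfl⟩ := hx
    induction hw using Submodule.span_induction with
    | mem y hy => obtain ⟨g, rfl⟩ := hy; simp [map_prod, inner_conj_symm]
    | zero => simp
    | add x y _ _ hx hy => simp [hx, hy]
    | smul c x _ hx => simp [hx]
  | zero => simp
  | add x y _ _ hx hy => simp [hx, hy]
  | smul c x _ hx => simp [hx]

theorem algForm_sum {n : ℕ} (c : Fin n → ℂ) (f : Fin n → ∀ k, H k) :
    algForm H (∑ j, c j • algTprod H (f j)) (∑ j, c j • algTprod H (f j)) =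
      dotProduct (star c) (Matrix.mulVec
        (Matrix.of fun i j => ∏ k, Matrix.gram ℂ (fun l => f l k) i j) c) := by
  simp only [map_sum, LinearMap.sum_apply, LinearMap.map_smulₛₗ, LinearMap.smul_apply,
    algForm_tprod, dotProduct, Matrix.mulVec, Matrix.of_apply, Matrix.gram_apply, smul_eq_mul,
    Finset.mul_sum, Pi.star_apply, RingHom.id_apply]
  refine Finset.sum_congr rfl fun i _ => Finset.sum_congr rfl fun j _ => ?_
  simp only [RCLike.star_def]
  ring

theorem posSemidef_prod {𝕜 : Type*} [RCLike 𝕜] {n : ℕ} {κ : Type*} (s : Finset κ)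
    (G : κ → Matrix (Fin n) (Fin n) 𝕜) (hG : ∀ k, (G k).PosSemidef) :
    (Matrix.of fun i j => ∏ k ∈ s, G k i j).PosSemidef := by
  classical
  induction s using Finset.induction_on with
  | empty =>
    convert Matrix.posSemidef_gram 𝕜 (fun _ : Fin n => (1 : 𝕜)) using 1
    ext i j
    simp [Matrix.gram_apply]
  | insert a s ha ih =>
    convert (hG a).hadamard ih using 1
    ext i j
    simp [Finset.prod_insert ha]

theorem posSemidef_prod_sub {𝕜 : Type*} [RCLike 𝕜] {n : ℕ} {κ : Type*} (s : Finset κ)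
    (G G' : κ → Matrix (Fin n) (Fin n) 𝕜) (hG : ∀ k, (G k).PosSemidef)
    (hG' : ∀ k, (G' k).PosSemidef) (h : ∀ k, (G k - G' k).PosSemidef) :
    ((Matrix.of fun i j => ∏ k ∈ s, G k i j) -
      Matrix.of fun i j => ∏ k ∈ s, G' k i j).PosSemidef := by
  classical
  induction s using Finset.induction_on with
  | empty =>
    convert (Matrix.PosSemidef.zero : (0 : Matrix (Fin n) (Fin n) 𝕜).PosSemidef) using 1
    ext i j
    simp
  | insert a s ha ih =>
    convert ((h a).hadamard (posSemidef_prod s G hG)).add ((hG' a).hadamard ih) using 1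
    ext i j
    simp only [Matrix.sub_apply, Matrix.of_apply, Matrix.add_apply, Matrix.hadamard_apply,
      Finset.prod_insert ha]
    ring

theorem algForm_self_nonneg (z : Alg H) : 0 ≤ algForm H z z := by
  obtain ⟨n, c, f, rfl⟩ := alg_exists_sum z
  rw [algForm_sum]
  exact (posSemidef_prod _ _ fun k => Matrix.posSemidef_gram ℂ _).dotProduct_mulVec_nonneg c

/-- The canonical inner product on the algebraic tensor product. Positive semidefiniteness is all that
the construction needs, as the completion below is Hausdorff. -/
@[reducible]
def algCore : PreInnerProductSpace.Core ℂ (Alg H) where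
  inner z w := algForm H w z
  conj_inner_symm z w := algForm_conj_symm z w
  re_inner_nonneg z := (RCLike.le_iff_re_im.1 (algForm_self_nonneg z)).1
  add_left x y z := by simp
  smul_left x y r := by simp

instance : SeminormedAddCommGroup (Alg H) :=
  @InnerProductSpace.Core.toSeminormedAddCommGroup ℂ (Alg H) _ _ _ algCore

instance : InnerProductSpace ℂ (Alg H) := InnerProductSpace.ofCore algCore

theorem alg_inner_def (z w : Alg H) : inner ℂ z w = algForm H w z := rfl

theorem alg_inner_tprod (f g : ∀ k, H k) :
    inner ℂ (algTprod H f) (algTprod H g) = ∏ k, inner ℂ (f k) (g k) := algForm_tprod f g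

theorem norm_algMap_le (A : ∀ k, H k →L[ℂ] H k) (z : Alg H) :
    ‖algMap A z‖ ≤ (∏ k, ‖A k‖) * ‖z‖ := by
  obtain ⟨n, c, f, rfl⟩ := alg_exists_sum z
  have hmap : algMap A (∑ j, c j • algTprod H (f j)) =
      ∑ j, c j • algTprod H (fun k => A k (f j k)) := by simp
  have hPS : ∀ k, (‖A k‖ ^ 2 • Matrix.gram ℂ (fun j => f j k)).PosSemidef := fun k =>
    (Matrix.posSemidef_gram ℂ _).smul (by positivity)
  have key := (posSemidef_prod_sub Finset.univ
    (fun k => ‖A k‖ ^ 2 • Matrix.gram ℂ (fun j => f j k))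
    (fun k => Matrix.gram ℂ (fun j => A k (f j k))) hPS
    (fun k => Matrix.posSemidef_gram ℂ _)
    (fun k => Matrix.posSemidef_opNorm_smul_gram_sub_gram (fun j => f j k) (A k))
    ).dotProduct_mulVec_nonneg c
  have hscale : (Matrix.of fun i j => ∏ k, (‖A k‖ ^ 2 • Matrix.gram ℂ (fun l => f l k)) i j) =
      ((∏ k, ‖A k‖) ^ 2) • Matrix.of fun i j => ∏ k, Matrix.gram ℂ (fun l => f l k) i j := by
    ext i j
    simp only [Matrix.of_apply, Matrix.smul_apply, Complex.real_smul, Finset.prod_mul_distrib]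
    push_cast
    rw [Finset.prod_pow]
  rw [hscale, Matrix.sub_mulVec, dotProduct_sub, Matrix.smul_mulVec, dotProduct_smul,
    ← algForm_sum, ← algForm_sum c fun j k => A k (f j k), ← hmap] at key
  have hre := (RCLike.le_iff_re_im.1 key).1
  rw [map_zero, map_sub, RCLike.smul_re, sub_nonneg] at hre
  refine le_of_sq_le_sq ?_ (by positivity)
  rw [mul_pow, ← inner_self_eq_norm_sq (𝕜 := ℂ), ← inner_self_eq_norm_sq (𝕜 := ℂ),
    alg_inner_def, alg_inner_def]
  exact hre

/-- The algebraic tensor product of bounded operators as a bounded operator. -/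
def algMapL (A : ∀ k, H k →L[ℂ] H k) : Alg H →L[ℂ] Alg H :=
  (algMap A).mkContinuous (∏ k, ‖A k‖) (norm_algMap_le A)

end Alg

end HilbertTensor

/-! ### The Hilbert space tensor product -/

/-- The tensor product `⨂ k, H k` of a finite family of Hilbert spaces: the (Hausdorff) completion
of the algebraic tensor product under the canonical inner product. -/
abbrev HilbertTensor {ι : Type*} [Fintype ι] (H : ι → Type*) [∀ k, NormedAddCommGroup (H k)]
    [∀ k, InnerProductSpace ℂ (H k)] : Type _ :=
  UniformSpace.Completion (HilbertTensor.Alg H)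

namespace HilbertTensor

variable {ι : Type*} [Fintype ι] {H : ι → Type*} [∀ k, NormedAddCommGroup (H k)]
  [∀ k, InnerProductSpace ℂ (H k)]

/-- The elementary tensor `⨂ f k` in the Hilbert space tensor product. -/
def tprod (f : ∀ k, H k) : HilbertTensor H := (algTprod H f : Alg H)

theorem inner_tprod (f g : ∀ k, H k) :
    inner ℂ (tprod f) (tprod g) = ∏ k, inner ℂ (f k) (g k) := by
  rw [tprod, tprod, UniformSpace.Completion.inner_coe, alg_inner_tprod]

/-- The tensor product `⨂ A k` of bounded operators: the continuous extension of
`⨂ f k ↦ ⨂ A k (f k)`. -/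
def map (A : ∀ k, H k →L[ℂ] H k) : HilbertTensor H →L[ℂ] HilbertTensor H :=
  (algMapL A).completion

theorem map_tprod (A : ∀ k, H k →L[ℂ] H k) (f : ∀ k, H k) :
    map A (tprod f) = tprod fun k => A k (f k) := by
  rw [map, tprod, tprod, ContinuousLinearMap.completion_apply_coe, ← algMap_tprod]
  rfl

theorem dense_span_tprod :
    Dense (Submodule.span ℂ (Set.range (tprod (H := H))) : Set (HilbertTensor H)) := by
  have himg : (Submodule.span ℂ (Set.range (tprod (H := H))) : Set (HilbertTensor H)) =
      Set.range ((↑) : Alg H → HilbertTensor H) := by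
    have hr : Set.range (tprod (H := H)) =
        (UniformSpace.Completion.toComplL : Alg H →L[ℂ] _).toLinearMap '' Set.range (algTprod H) := by
      rw [← Set.range_comp]; rfl
    rw [hr, Submodule.span_image, alg_span, Submodule.map_top]
    rfl
  rw [himg]
  exact UniformSpace.Completion.denseRange_coe

theorem clm_ext {A B : HilbertTensor H →L[ℂ] HilbertTensor H}
    (h : ∀ f, A (tprod f) = B (tprod f)) : A = B := by
  refine ContinuousLinearMap.ext_on dense_span_tprod ?_
  rintro _ ⟨f, rfl⟩
  exact h f

theorem map_one : map (fun k => (1 : H k →L[ℂ] H k)) = 1 := clm_ext fun f => by simp [map_tprod]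

theorem map_mul (A B : ∀ k, H k →L[ℂ] H k) :
    map (fun k => A k * B k) = map A * map B := clm_ext fun f => by simp [map_tprod]

end HilbertTensor

/-! ### One-parameter operator semigroups -/

/-- A semigroup `(T(t))_{t ≥ 0}` of bounded operators on `H`: `T(0) = I` and
`T(s + t) = T(s) T(t)`. No continuity is required. -/
structure OpSemigroup (H : Type*) [NormedAddCommGroup H] [InnerProductSpace ℂ H] where
  /-- The operator `T(t)`. -/
  op : ℝ≥0 → H →L[ℂ] H
  op_zero : op 0 = 1
  op_add : ∀ s t, op (s + t) = op s * op t

namespace OpSemigroup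

variable {H : Type*} [NormedAddCommGroup H] [InnerProductSpace ℂ H]

/-- Strong continuity on `(0, ∞)`; nothing is asked at `t = 0`. -/
def StronglyContinuousOnIoi (T : OpSemigroup H) : Prop :=
  ∀ h : H, ContinuousOn (fun t => T.op t h) (Set.Ioi 0)

/-- The semigroup is nonzero: `T(t) ≠ 0` for some `t > 0`. (The condition would be void if `t = 0`
were admitted, as `T(0) = I`.) -/
def IsNonzero (T : OpSemigroup H) : Prop := ∃ t, 0 < t ∧ T.op t ≠ 0

/-- The rescaled semigroup `e_d T = (e^{dt} T(t))_{t ≥ 0}`. -/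
def rescale (d : ℝ) (T : OpSemigroup H) : OpSemigroup H where
  op t := ((Real.exp (d * t) : ℝ) : ℂ) • T.op t
  op_zero := by simp [T.op_zero]
  op_add s t := by
    rw [T.op_add, NNReal.coe_add, mul_add, Real.exp_add, Complex.ofReal_mul, smul_mul_smul_comm]

/-- A contraction semigroup: `‖T(t)‖ ≤ 1` for all `t ≥ 0`. -/
def IsContraction (T : OpSemigroup H) : Prop := ∀ t, ‖T.op t‖ ≤ 1

/-- A quasi-contraction semigroup: some rescaling is a contraction semigroup. -/
def IsQuasiContraction (T : OpSemigroup H) : Prop := ∃ a : ℝ, (T.rescale a).IsContraction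

/-- Similarity of semigroups: `T(t) = R S(t) R⁻¹` for all `t ≥ 0`, with one boundedly invertible
operator `R`. -/
def IsSimilar (T S : OpSemigroup H) : Prop :=
  ∃ R : H ≃L[ℂ] H, ∀ t, T.op t = (R : H →L[ℂ] H) ∘L S.op t ∘L (R.symm : H →L[ℂ] H)

/-- The class `SC(H)`: semigroups similar to a contraction semigroup. -/
def IsSC (T : OpSemigroup H) : Prop := ∃ S : OpSemigroup H, S.IsContraction ∧ T.IsSimilar S

/-- The class `SQC(H)`: semigroups similar to a quasi-contraction semigroup. -/
def IsSQC (T : OpSemigroup H) : Prop := ∃ S : OpSemigroup H, S.IsQuasiContraction ∧ T.IsSimilar S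

/-- The tensor product semigroup `(⨂ k, T k (t))_{t ≥ 0}` on `⨂ k, H k`. -/
def tensor {ι : Type*} [Fintype ι] {H : ι → Type*} [∀ k, NormedAddCommGroup (H k)]
    [∀ k, InnerProductSpace ℂ (H k)] (T : ∀ k, OpSemigroup (H k)) :
    OpSemigroup (HilbertTensor H) where
  op t := HilbertTensor.map fun k => (T k).op t
  op_zero := by simp only [op_zero, HilbertTensor.map_one]
  op_add s t := by simp only [op_add, HilbertTensor.map_mul]

end OpSemigroup

end

noncomputable section

open scoped NNReal TensorProduct ComplexOrder

open Filter Topology MeasureTheory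

/-! ### Hilbertian quadratic forms -/

section Form

variable {H : Type*} [NormedAddCommGroup H] [InnerProductSpace ℂ H]

/-! A semigroup is similar to a contraction semigroup exactly when it contracts some equivalent
Hilbert norm (`isSC_iff`), and every coercive bounded positive form is the square of such a norm
(`IsHilbertForm.exists_equiv`). The two "if" directions only tensor the similarities and add up the
rates. For the converses, a norm contracted by the tensor semigroup has to yield a norm on one
factor `H j`.

Let `R` carry the contracted norm, fix vectors `x k`, and let A(s)h be `R` applied to the elementary
tensor with `h` in slot `j` and `T_k(s) x_k` in the others. Then ‖A(s+t) T_j(t) h‖ ≤ ‖A(s) h‖, so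
for N(h) = ∫_a^b ‖A(s)h‖² ds the substitution s ↦ s+t gives N(T_j(t)h) ≤ N(h) + ∫_{a-t}^a ‖A(s)h‖²
ds − ∫_{b-t}^b ‖A(s)h‖² ds. If A(s) is bounded above and below, the gain is O(t) N(h), and `T j` is
similar to a quasi-contraction semigroup (`isSQC_of_isSC_tensor`). This settles (i).

For (ii), consider the rates d for which e_d `T k` is exponentially stable; they form an open
down-set of ℝ. If stable rates with sum zero exist, each e_{d_k} `T k` is both exponentially stable
and quasi-contractive up to similarity, which makes it similar to a contraction semigroup
(`isSC_of_isSQC_of_norm_lt_one`). Otherwise all suprema δ_k are finite. Their sum is at most 0,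
since a positive excess could be shared out, and at least 0, since the tensor semigroup is bounded
while no e_{δ_k} `T k` is stable. So the sum is 0, and each e_{δ_k} T_k(1) has spectral radius one,
hence approximate eigenvectors with a unimodular eigenvalue. With these as `x k`, ‖A(s)h‖ is nearly
1-periodic in s; averaged over a full period, the gain and the loss cancel in the limit, leaving a
contracted form (`isSC_of_isSC_tensor_of_isApproxEigenvector`). -/

/-- `N` is the quadratic form of a bounded positive operator. -/
def IsHilbertForm (N : H → ℝ) : Prop :=
  ∃ P : H →L[ℂ] H, P.IsPositive ∧ ∀ h, N h = P.reApplyInnerSelf h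

theorem IsHilbertForm.add {N N' : H → ℝ} (hN : IsHilbertForm N) (hN' : IsHilbertForm N') :
    IsHilbertForm fun h => N h + N' h := by
  obtain ⟨P, hP, hNP⟩ := hN
  obtain ⟨Q, hQ, hNQ⟩ := hN'
  exact ⟨P + Q, hP.add hQ, fun h => by
    simp [hNP, hNQ, ContinuousLinearMap.reApplyInnerSelf, inner_add_left]⟩

theorem IsHilbertForm.const_mul {N : H → ℝ} (hN : IsHilbertForm N) {C : ℝ} (hC : 0 ≤ C) :
    IsHilbertForm fun h => C * N h := by
  obtain ⟨P, hP, hNP⟩ := hN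
  refine ⟨(C : ℂ) • P, hP.smul_of_nonneg (by simpa using hC), fun h => ?_⟩
  simp [hNP, ContinuousLinearMap.reApplyInnerSelf]

variable [CompleteSpace H]

theorem exists_isPositive_of_form (B : H → H → ℂ) (C : ℝ)
    (add_left : ∀ x y z, B (x + y) z = B x z + B y z)
    (smul_right : ∀ (c : ℂ) x y, B x (c • y) = c * B x y)
    (conj_symm : ∀ x y, starRingEnd ℂ (B x y) = B y x)
    (nonneg : ∀ x, 0 ≤ (B x x).re) (bound : ∀ x y, ‖B x y‖ ≤ C * ‖x‖ * ‖y‖) :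
    ∃ P : H →L[ℂ] H, P.IsPositive ∧ ∀ x y, inner ℂ (P x) y = B x y := by
  have add_right : ∀ x y z, B x (y + z) = B x y + B x z := fun x y z => by
    rw [← conj_symm, add_left, map_add, conj_symm, conj_symm]
  have smul_left : ∀ (c : ℂ) x y, B (c • x) y = starRingEnd ℂ c * B x y := fun c x y => by
    rw [← conj_symm, smul_right, map_mul, conj_symm]
  let B' : H →L⋆[ℂ] H →L[ℂ] ℂ := LinearMap.mkContinuous₂
    (LinearMap.mk₂'ₛₗ (starRingEnd ℂ) (RingHom.id ℂ) B add_left smul_left add_right smul_right)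
    C bound
  have hB : ∀ x y, inner ℂ (InnerProductSpace.continuousLinearMapOfBilin B' x) y = B x y :=
    fun x y => InnerProductSpace.continuousLinearMapOfBilin_apply B' x y
  refine ⟨InnerProductSpace.continuousLinearMapOfBilin B', ⟨fun x y => ?_, fun x => ?_⟩, hB⟩
  · rw [ContinuousLinearMap.coe_coe, hB, ← inner_conj_symm, hB, conj_symm]
  · rw [ContinuousLinearMap.reApplyInnerSelf_apply, hB]
    exact nonneg x

theorem isHilbertForm_norm_sq {E : Type*} [NormedAddCommGroup E] [InnerProductSpace ℂ E]
    (A : H →L[ℂ] E) : IsHilbertForm fun h => ‖A h‖ ^ 2 := by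
  obtain ⟨P, hP, h⟩ := exists_isPositive_of_form (fun x y => inner ℂ (A x) (A y)) (‖A‖ * ‖A‖)
    (fun x y z => by simp) (fun c x y => by simp)
    (fun x y => inner_conj_symm _ _)
    (fun x => inner_self_nonneg (𝕜 := ℂ))
    (fun x y => (norm_inner_le_norm _ _).trans <| by
      calc ‖A x‖ * ‖A y‖ ≤ (‖A‖ * ‖x‖) * (‖A‖ * ‖y‖) := by
            gcongr <;> exact A.le_opNorm _
        _ = _ := by ring)
  refine ⟨P, hP, fun x => ?_⟩
  rw [ContinuousLinearMap.reApplyInnerSelf_apply, h, inner_self_eq_norm_sq]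

theorem integrableOn_norm_sq {E : Type*} [NormedAddCommGroup E] {f : ℝ → E} {a b C : ℝ}
    (hf : ContinuousOn f (Set.Ioo a b)) (hC : ∀ s ∈ Set.Ioo a b, ‖f s‖ ≤ C) :
    IntegrableOn (fun s => ‖f s‖ ^ 2) (Set.Ioo a b) := by
  refine Integrable.of_bound ((hf.norm.pow 2).aestronglyMeasurable measurableSet_Ioo) (C ^ 2) ?_
  refine (ae_restrict_mem measurableSet_Ioo).mono fun s hs => ?_
  rw [Real.norm_of_nonneg (by positivity)]
  have := hC s hs
  gcongr

/-- Integrating the sesquilinear forms ⟪A(s)x, A(s)y⟫ preserves positivity and boundedness. The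
interval is open because an endpoint may correspond to time zero of a semigroup, where continuity is
not assumed. -/
theorem isHilbertForm_integral {E : Type*} [NormedAddCommGroup E] [InnerProductSpace ℂ E]
    (A : ℝ → H →L[ℂ] E) {a b C : ℝ} (hC0 : 0 ≤ C)
    (hA : ∀ h, ContinuousOn (fun s => A s h) (Set.Ioo a b))
    (hC : ∀ s ∈ Set.Ioo a b, ∀ h, ‖A s h‖ ≤ C * ‖h‖) :
    IsHilbertForm fun h => ∫ s in Set.Ioo a b, ‖A s h‖ ^ 2 := by
  have hbd : ∀ x y, ∀ s ∈ Set.Ioo a b, ‖inner ℂ (A s x) (A s y)‖ ≤ C * C * ‖x‖ * ‖y‖ :=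
    fun x y s hs => (norm_inner_le_norm _ _).trans <| by
      calc ‖A s x‖ * ‖A s y‖ ≤ (C * ‖x‖) * (C * ‖y‖) := by
            gcongr <;> exact hC s hs _
        _ = _ := by ring
  have hint : ∀ x y, IntegrableOn (fun s => inner ℂ (A s x) (A s y)) (Set.Ioo a b) := fun x y =>
    Integrable.of_bound (((hA x).inner (hA y)).aestronglyMeasurable measurableSet_Ioo)
      (C * C * ‖x‖ * ‖y‖) ((ae_restrict_mem measurableSet_Ioo).mono (hbd x y))
  have hself : ∀ x, ∫ s in Set.Ioo a b, inner ℂ (A s x) (A s x)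
      = ((∫ s in Set.Ioo a b, ‖A s x‖ ^ 2 : ℝ) : ℂ) := fun x => by
    rw [← integral_complex_ofReal]
    refine integral_congr_ae (Eventually.of_forall fun s => ?_)
    simp [inner_self_eq_norm_sq_to_K]
  obtain ⟨P, hP, h⟩ := exists_isPositive_of_form
    (fun x y => ∫ s in Set.Ioo a b, inner ℂ (A s x) (A s y))
    (volume.real (Set.Ioo a b) * (C * C))
    (fun x y z => by
      simp only [map_add, inner_add_left]
      exact integral_add (hint x z) (hint y z))
    (fun c x y => by
      simp only [map_smul, inner_smul_right]
      exact integral_const_mul _ _)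
    (fun x y => by
      rw [← integral_conj]
      simp only [inner_conj_symm])
    (fun x => by
      rw [hself, Complex.ofReal_re]
      exact integral_nonneg fun s => by positivity)
    (fun x y => by
      refine (norm_setIntegral_le_of_norm_le_const (by simp) (hbd x y)).trans (le_of_eq ?_)
      ring)
  refine ⟨P, hP, fun x => ?_⟩
  rw [ContinuousLinearMap.reApplyInnerSelf_apply, h, hself]
  simp

/-- Pointwise limits of uniformly bounded Hilbertian forms along an ultrafilter. -/
theorem exists_isHilbertForm_tendsto {κ : Type*} (U : Ultrafilter κ) (N : κ → H → ℝ) (C : ℝ)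
    (hN : ∀ n, IsHilbertForm (N n)) (hC : ∀ n h, N n h ≤ C * ‖h‖ ^ 2) :
    ∃ N' : H → ℝ, IsHilbertForm N' ∧ ∀ h, Tendsto (fun n => N n h) U (𝓝 (N' h)) := by
  choose P hP hNP using hN
  have hC0 : 0 ≤ |C| := abs_nonneg C
  have hnn : ∀ n h, 0 ≤ (P n).reApplyInnerSelf h := fun n h => (hP n).2 h
  have hbd : ∀ x y n, inner ℂ (P n x) y ∈ Metric.closedBall (0 : ℂ) (|C| * ‖x‖ * ‖y‖) := by
    intro x y n
    rw [mem_closedBall_zero_iff]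
    -- For a symmetric operator the quadratic form controls the norm, which puts all the inner
    -- products below in one compact disc.
    have hle : ‖P n‖ ≤ |C| := by
      rw [(P n).norm_eq_iSup_rayleighQuotient (hP n).isSymmetric]
      refine ciSup_le fun h => ?_
      rw [ContinuousLinearMap.rayleighQuotient, abs_of_nonneg (div_nonneg (hnn n h) (by positivity))]
      refine div_le_of_le_mul₀ (by positivity) hC0 ?_
      rw [← hNP]
      exact (hC n h).trans (by gcongr; exact le_abs_self C)
    calc ‖inner ℂ (P n x) y‖ ≤ ‖P n x‖ * ‖y‖ := norm_inner_le_norm _ _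
      _ ≤ |C| * ‖x‖ * ‖y‖ := by
        gcongr
        exact (P n).le_of_opNorm_le hle x
  have hlim : ∀ x y, ∃ z, Tendsto (fun n => inner ℂ (P n x) y) U (𝓝 z) := fun x y => by
    obtain ⟨z, -, hz⟩ := (isCompact_closedBall (0 : ℂ) (|C| * ‖x‖ * ‖y‖)).ultrafilter_le_nhds
      (U.map fun n => inner ℂ (P n x) y) (by
        rw [Ultrafilter.coe_map, le_principal_iff, mem_map]
        exact Eventually.of_forall (hbd x y))
    exact ⟨z, hz⟩
  choose B hB using hlim
  obtain ⟨Q, hQ, h⟩ := exists_isPositive_of_form B |C|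
    (fun x y z => tendsto_nhds_unique (hB (x + y) z) (by
      simpa [inner_add_left] using (hB x z).add (hB y z)))
    (fun c x y => tendsto_nhds_unique (hB x (c • y)) (by
      simpa [inner_smul_right] using (hB x y).const_mul c))
    (fun x y => tendsto_nhds_unique ((Complex.continuous_conj.tendsto _).comp (hB x y)) (by
      refine (hB y x).congr fun n => ?_
      rw [Function.comp_apply, inner_conj_symm]
      exact (hP n).isSymmetric y x))
    (fun x => ge_of_tendsto' ((Complex.continuous_re.tendsto _).comp (hB x x)) fun n => hnn n x)
    (fun x y => by
      have := (Metric.isClosed_closedBall (x := (0 : ℂ)) (ε := |C| * ‖x‖ * ‖y‖)).mem_of_tendsto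
        (hB x y) (Eventually.of_forall (hbd x y))
      simpa using this)
  refine ⟨fun x => Q.reApplyInnerSelf x, ⟨Q, hQ, fun _ => rfl⟩, fun x => ?_⟩
  simp only [ContinuousLinearMap.reApplyInnerSelf_apply, h]
  exact ((Complex.continuous_re.tendsto _).comp (hB x x)).congr fun n => (hNP n x).symm

/-- A coercive Hilbertian form is the square of an equivalent norm. -/
theorem IsHilbertForm.exists_equiv {N : H → ℝ} (hN : IsHilbertForm N) {c : ℝ} (hc : 0 < c)
    (hcN : ∀ h, c * ‖h‖ ^ 2 ≤ N h) : ∃ R : H ≃L[ℂ] H, ∀ h, N h = ‖R h‖ ^ 2 := by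
  obtain ⟨P, hP, hNP⟩ := hN
  have hP0 : 0 ≤ P := (ContinuousLinearMap.nonneg_iff_isPositive P).2 hP
  have hu : IsUnit P := by
    refine P.isUnit_of_forall_le_norm_inner_map (c := ⟨c, hc.le⟩) hc fun x => ?_
    refine le_trans ?_ (Complex.re_le_norm _)
    have := hcN x
    rw [hNP, ContinuousLinearMap.reApplyInnerSelf_apply] at this
    rw [mul_comm]
    exact this
  obtain ⟨u, huS⟩ := (CFC.isUnit_sqrt_iff P hP0).2 hu
  have hS : CFC.sqrt P * CFC.sqrt P = P := CFC.sqrt_mul_sqrt_self P hP0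
  have hSs : IsSelfAdjoint (CFC.sqrt P) := (CFC.sqrt_nonneg P).isSelfAdjoint
  refine ⟨ContinuousLinearEquiv.ofUnit u, fun h => ?_⟩
  have hR : ContinuousLinearEquiv.ofUnit u h = CFC.sqrt P h := by rw [← huS]; rfl
  rw [hR, hNP, ContinuousLinearMap.reApplyInnerSelf_apply, ← inner_self_eq_norm_sq (𝕜 := ℂ)]
  conv_lhs => rw [← hS]
  rw [mul_apply_eq_comp]
  congr 1
  exact hSs.isSymmetric _ _

end Form

/-! ### Elementary tensors and tensor products of operators -/

namespace HilbertTensor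

variable {ι : Type*} [Fintype ι] {H : ι → Type*} [∀ k, NormedAddCommGroup (H k)]
  [∀ k, InnerProductSpace ℂ (H k)]

theorem norm_tprod (f : ∀ k, H k) : ‖tprod f‖ = ∏ k, ‖f k‖ := by
  have h : ((‖tprod f‖ ^ 2 : ℝ) : ℂ) = (((∏ k, ‖f k‖) ^ 2 : ℝ) : ℂ) := by
    rw [← Finset.prod_pow]
    push_cast
    have := inner_tprod f f
    simp only [inner_self_eq_norm_sq_to_K] at this
    exact this
  exact (sq_eq_sq₀ (norm_nonneg _) (Finset.prod_nonneg fun k _ => norm_nonneg _)).1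
    (Complex.ofReal_injective h)

variable (H) in
/-- The elementary tensor as a continuous multilinear map. -/
def tprodL : ContinuousMultilinearMap ℂ H (HilbertTensor H) :=
  ((UniformSpace.Completion.toComplL : Alg H →L[ℂ] _).toLinearMap.compMultilinearMap
    (algTprod H)).mkContinuous 1 fun f => by
      rw [one_mul]
      exact (norm_tprod f).le

theorem norm_map_le (A : ∀ k, H k →L[ℂ] H k) : ‖map A‖ ≤ ∏ k, ‖A k‖ := by
  have h0 : 0 ≤ ∏ k, ‖A k‖ := Finset.prod_nonneg fun k _ => norm_nonneg _
  refine ContinuousLinearMap.opNorm_le_bound _ h0 fun z => ?_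
  induction z using UniformSpace.Completion.induction_on with
  | hp => exact isClosed_le (map A).continuous.norm (by fun_prop)
  | ih z =>
    rw [map, ContinuousLinearMap.completion_apply_coe, UniformSpace.Completion.norm_coe,
      UniformSpace.Completion.norm_coe]
    exact norm_algMap_le A z

/-- Testing on elementary tensors of vectors that attain each norm up to a factor 2 suffices. The
constant is not sharp, but it is only compared with an exponentially decaying quantity. -/
theorem prod_norm_le (A : ∀ k, H k →L[ℂ] H k) :
    ∏ k, ‖A k‖ ≤ 2 ^ Fintype.card ι * ‖map A‖ := by
  have hex : ∀ k, ∃ f : H k, ‖f‖ ≤ 1 ∧ ‖A k‖ ≤ 2 * ‖A k f‖ := by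
    intro k
    by_contra! hcon
    have hpos : 0 < ‖A k‖ := by simpa using hcon 0 (by simp)
    have hle : ‖A k‖ ≤ ‖A k‖ / 2 := ContinuousLinearMap.opNorm_le_of_unit_norm (by positivity)
      fun x hx => by
        have := hcon x hx.le
        linarith
    linarith
  choose f hf hAf using hex
  calc ∏ k, ‖A k‖ ≤ ∏ k, (2 * ‖A k (f k)‖) :=
        Finset.prod_le_prod (fun k _ => norm_nonneg _) fun k _ => hAf k
    _ = 2 ^ Fintype.card ι * ‖map A (tprod f)‖ := by
        rw [Finset.prod_mul_distrib, map_tprod, norm_tprod, Finset.prod_const, Finset.card_univ]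
    _ ≤ 2 ^ Fintype.card ι * (‖map A‖ * 1) := by
        gcongr
        refine (map A).le_opNorm_of_le ?_
        rw [norm_tprod]
        exact Finset.prod_le_one (fun k _ => norm_nonneg _) fun k _ => hf k
    _ = _ := by rw [mul_one]

theorem map_smul (c : ι → ℂ) (A : ∀ k, H k →L[ℂ] H k) :
    map (fun k => c k • A k) = (∏ k, c k) • map A := clm_ext fun f => by
  rw [map_tprod, smul_apply, map_tprod]
  exact (tprodL H).map_smul_univ c fun k => A k (f k)

/-- The tensor product of invertible operators. -/
def mapEquiv (R : ∀ k, H k ≃L[ℂ] H k) : HilbertTensor H ≃L[ℂ] HilbertTensor H :=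
  ContinuousLinearEquiv.ofUnit
    { val := map fun k => (R k : H k →L[ℂ] H k)
      inv := map fun k => ((R k).symm : H k →L[ℂ] H k)
      val_inv := by
        rw [← map_mul, ← map_one]
        congr 1
        ext k x
        simp
      inv_val := by
        rw [← map_mul, ← map_one]
        congr 1
        ext k x
        simp }

end HilbertTensor

/-! ### Semigroups -/

namespace OpSemigroup

section Basic

variable {H : Type*} [NormedAddCommGroup H] [InnerProductSpace ℂ H]

theorem ext_op {T S : OpSemigroup H} (h : ∀ t, T.op t = S.op t) : T = S := by
  cases T
  cases S
  congr 1
  exact funext h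

theorem rescale_apply (T : OpSemigroup H) (d : ℝ) (t : ℝ≥0) (h : H) :
    (T.rescale d).op t h = ((Real.exp (d * t) : ℝ) : ℂ) • T.op t h := rfl

theorem norm_rescale (T : OpSemigroup H) (d : ℝ) (t : ℝ≥0) :
    ‖(T.rescale d).op t‖ = Real.exp (d * t) * ‖T.op t‖ := by
  change ‖((Real.exp (d * t) : ℝ) : ℂ) • T.op t‖ = _
  rw [norm_smul, Complex.norm_real, Real.norm_of_nonneg (Real.exp_pos _).le]

theorem rescale_rescale (T : OpSemigroup H) (d e : ℝ) :
    (T.rescale d).rescale e = T.rescale (d + e) := ext_op fun t => by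
  change (_ : ℂ) • (_ : ℂ) • T.op t = (_ : ℂ) • T.op t
  rw [smul_smul, ← Complex.ofReal_mul, ← Real.exp_add]
  congr 3
  ring

theorem rescale_zero (T : OpSemigroup H) : T.rescale 0 = T := ext_op fun t => by
  change (_ : ℂ) • T.op t = T.op t
  simp

theorem op_nsmul (T : OpSemigroup H) (n : ℕ) (t : ℝ≥0) : T.op (n • t) = T.op t ^ n := by
  induction n with
  | zero => simp [T.op_zero]
  | succ n ih => rw [succ_nsmul, T.op_add, ih, pow_succ]

theorem op_natCast (T : OpSemigroup H) (n : ℕ) : T.op n = T.op 1 ^ n := by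
  rw [← op_nsmul, nsmul_one]

theorem op_add_apply (T : OpSemigroup H) (s t : ℝ≥0) (h : H) :
    T.op (s + t) h = T.op s (T.op t h) := by
  rw [T.op_add]
  rfl

/-- Conjugation by `R` turns contractivity in the norm ‖R ·‖ into contractivity in the original
norm. The `R` here is the inverse of the one in `IsSimilar`. -/
theorem isSC_iff {T : OpSemigroup H} :
    T.IsSC ↔ ∃ R : H ≃L[ℂ] H, ∀ t h, ‖R (T.op t h)‖ ≤ ‖R h‖ := by
  constructor
  · rintro ⟨S, hS, R, hR⟩
    refine ⟨R.symm, fun t h => ?_⟩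
    rw [hR]
    simpa using (S.op t).le_of_opNorm_le (hS t) (R.symm h)
  · rintro ⟨R, hR⟩
    refine ⟨⟨fun t => (R : H →L[ℂ] H) ∘L T.op t ∘L (R.symm : H →L[ℂ] H), ?_, ?_⟩, ?_, R.symm, ?_⟩
    · ext x
      simp [T.op_zero]
    · intro s t
      ext x
      simp [T.op_add]
    · intro t
      refine ContinuousLinearMap.opNorm_le_bound _ zero_le_one fun x => ?_
      simpa using hR t (R.symm x)
    · intro t
      ext x
      simp

theorem IsSimilar.rescale {T S : OpSemigroup H} (h : T.IsSimilar S) (a : ℝ) :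
    (T.rescale a).IsSimilar (S.rescale a) := by
  obtain ⟨R, hR⟩ := h
  refine ⟨R, fun t => ?_⟩
  ext x
  simp [rescale_apply, hR]

theorem isSQC_iff {T : OpSemigroup H} : T.IsSQC ↔ ∃ a, (T.rescale a).IsSC := by
  constructor
  · rintro ⟨S, ⟨a, ha⟩, hTS⟩
    exact ⟨a, S.rescale a, ha, hTS.rescale a⟩
  · rintro ⟨a, S, hS, hTS⟩
    refine ⟨S.rescale (-a), ⟨a, ?_⟩, ?_⟩
    · rwa [rescale_rescale, neg_add_cancel, rescale_zero]
    · simpa [rescale_rescale, rescale_zero] using hTS.rescale (-a)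

theorem IsSQC.rescale {T : OpSemigroup H} (hT : T.IsSQC) (d : ℝ) : (T.rescale d).IsSQC := by
  obtain ⟨a, ha⟩ := isSQC_iff.1 hT
  refine isSQC_iff.2 ⟨a - d, ?_⟩
  rwa [rescale_rescale, add_sub_cancel]

theorem IsNonzero.rescale {T : OpSemigroup H} (hT : T.IsNonzero) (d : ℝ) :
    (T.rescale d).IsNonzero := by
  obtain ⟨t, ht, h⟩ := hT
  refine ⟨t, ht, ?_⟩
  rw [← norm_ne_zero_iff, norm_rescale]
  exact mul_ne_zero (Real.exp_pos _).ne' (norm_ne_zero_iff.2 h)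

theorem StronglyContinuousOnIoi.rescale {T : OpSemigroup H} (hT : T.StronglyContinuousOnIoi)
    (d : ℝ) : (T.rescale d).StronglyContinuousOnIoi := by
  intro h
  simp only [rescale_apply]
  exact ContinuousOn.smul (by fun_prop) (hT h)

/-- An exponential bound for small times extends to all times. -/
theorem le_exp_of_le_exp_small {T : OpSemigroup H} {N : H → ℝ} {a : ℝ} {τ : ℝ≥0} (hτ : 0 < τ)
    (hN : ∀ t, 0 < t → t ≤ τ → ∀ h, N (T.op t h) ≤ Real.exp (a * t) * N h) (t : ℝ≥0) (h : H) :
    N (T.op t h) ≤ Real.exp (a * t) * N h := by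
  rcases eq_zero_or_pos t with rfl | ht
  · simp [T.op_zero]
  obtain ⟨n, hn⟩ := exists_nat_ge (t / τ)
  have hn0 : 0 < (n : ℝ≥0) := lt_of_lt_of_le (by positivity) hn
  have hstep : t / n ≤ τ := by
    rw [div_le_iff₀ hτ] at hn
    rwa [div_le_iff₀ hn0, mul_comm]
  have key : ∀ k : ℕ, N (T.op (k • (t / n)) h) ≤ Real.exp (a * (k * (t / n : ℝ≥0))) * N h := by
    intro k
    induction k with
    | zero => simp [T.op_zero]
    | succ k ih =>
      rw [succ_nsmul', op_add_apply]
      calc _ ≤ Real.exp (a * (t / n : ℝ≥0)) * N (T.op (k • (t / n)) h) :=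
            hN _ (by positivity) hstep _
        _ ≤ Real.exp (a * (t / n : ℝ≥0)) * (Real.exp (a * (k * (t / n : ℝ≥0))) * N h) := by
            gcongr
        _ = _ := by
            rw [← mul_assoc, ← Real.exp_add]
            push_cast
            ring_nf
  have ht' : n • (t / n) = t := by
    rw [nsmul_eq_mul, mul_div_cancel₀ _ hn0.ne']
  have := key n
  rw [ht'] at this
  rwa [show ((n : ℝ) * (t / n : ℝ≥0)) = t by
    exact_mod_cast congrArg NNReal.toReal (mul_div_cancel₀ t hn0.ne')] at this

theorem isSC_rescale_of_form [CompleteSpace H] {T : OpSemigroup H} {N : H → ℝ}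
    (hN : IsHilbertForm N) {c : ℝ} (hc : 0 < c) (hcN : ∀ h, c * ‖h‖ ^ 2 ≤ N h) {a : ℝ} {τ : ℝ≥0}
    (hτ : 0 < τ)
    (hNT : ∀ t, 0 < t → t ≤ τ → ∀ h, N (T.op t h) ≤ Real.exp (2 * a * t) * N h) :
    (T.rescale (-a)).IsSC := by
  obtain ⟨R, hR⟩ := hN.exists_equiv hc hcN
  refine isSC_iff.2 ⟨R, fun t h => ?_⟩
  have := le_exp_of_le_exp_small hτ hNT t h
  rw [hR, hR] at this
  refine le_of_sq_le_sq ?_ (norm_nonneg _)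
  rw [rescale_apply, R.map_smul, norm_smul, Complex.norm_real,
    Real.norm_of_nonneg (Real.exp_pos _).le, mul_pow, ← Real.exp_nat_mul]
  calc _ ≤ Real.exp ((2 : ℕ) * (-a * t)) * (Real.exp (2 * a * t) * ‖R h‖ ^ 2) := by gcongr
    _ = ‖R h‖ ^ 2 := by
      rw [← mul_assoc, ← Real.exp_add]
      convert one_mul _
      rw [Real.exp_eq_one_iff]
      push_cast
      ring

theorem isSC_of_form [CompleteSpace H] {T : OpSemigroup H} {N : H → ℝ}
    (hN : IsHilbertForm N) {c : ℝ} (hc : 0 < c) (hcN : ∀ h, c * ‖h‖ ^ 2 ≤ N h) {τ : ℝ≥0}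
    (hτ : 0 < τ) (hNT : ∀ t, 0 < t → t ≤ τ → ∀ h, N (T.op t h) ≤ N h) : T.IsSC := by
  simpa [rescale_zero] using isSC_rescale_of_form (a := 0) hN hc hcN hτ (by simpa using hNT)

/-- The semigroup with real time, constant for negative times. -/
def opR (T : OpSemigroup H) (s : ℝ) : H →L[ℂ] H := T.op s.toNNReal

theorem opR_coe (T : OpSemigroup H) (t : ℝ≥0) : T.opR t = T.op t := by simp [opR]

theorem opR_add (T : OpSemigroup H) {s t : ℝ} (hs : 0 ≤ s) (ht : 0 ≤ t) (h : H) :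
    T.opR (s + t) h = T.opR s (T.opR t h) := by
  rw [opR, Real.toNNReal_add hs ht, op_add_apply]
  rfl

theorem StronglyContinuousOnIoi.opR {T : OpSemigroup H} (hT : T.StronglyContinuousOnIoi) (h : H) :
    ContinuousOn (fun s => T.opR s h) (Set.Ioi 0) :=
  (hT h).comp continuous_real_toNNReal.continuousOn fun s hs => by simpa using hs

/-- Uniform boundedness on a compact interval. The interval must avoid 0, where strong continuity is
not assumed; hence all averaging windows below stay away from 0 or use a quasi-contractive bound. -/
theorem StronglyContinuousOnIoi.exists_bound [CompleteSpace H] {T : OpSemigroup H}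
    (hT : T.StronglyContinuousOnIoi) {a : ℝ} (ha : 0 < a) (b : ℝ) :
    ∃ M, 0 < M ∧ ∀ s ∈ Set.Icc a b, ∀ h, ‖T.opR s h‖ ≤ M * ‖h‖ := by
  obtain ⟨M, hM⟩ := banach_steinhaus (g := fun s : Set.Icc a b => T.opR s) fun x => by
    obtain ⟨C, hC⟩ := isCompact_Icc.exists_bound_of_continuousOn
      ((hT.opR x).mono (t := Set.Icc a b) fun s hs => ha.trans_le hs.1)
    exact ⟨C, fun s => hC s s.2⟩
  refine ⟨max M 1, by positivity, fun s hs h => ?_⟩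
  exact (T.opR s).le_of_opNorm_le ((hM ⟨s, hs⟩).trans (le_max_left _ _)) h

end Basic

section Tensor

variable {ι : Type*} [Fintype ι] {H : ι → Type*} [∀ k, NormedAddCommGroup (H k)]
  [∀ k, InnerProductSpace ℂ (H k)]

theorem tensor_rescale (T : ∀ k, OpSemigroup (H k)) (d : ι → ℝ) :
    tensor (fun k => (T k).rescale (d k)) = (tensor T).rescale (∑ k, d k) := ext_op fun t => by
  refine (HilbertTensor.map_smul _ _).trans ?_
  change _ = (_ : ℂ) • (tensor T).op t
  congr 1
  rw [← Complex.ofReal_prod, ← Real.exp_sum, Finset.sum_mul]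

theorem isSC_tensor {T : ∀ k, OpSemigroup (H k)} (hT : ∀ k, (T k).IsSC) : (tensor T).IsSC := by
  choose S hS R hR using hT
  refine ⟨tensor S, fun t => ?_, HilbertTensor.mapEquiv R, fun t => ?_⟩
  · exact (HilbertTensor.norm_map_le _).trans
      (Finset.prod_le_one (fun k _ => norm_nonneg _) fun k _ => hS k t)
  · change HilbertTensor.map (fun k => (T k).op t) = HilbertTensor.map _ ∘L
      HilbertTensor.map (fun k => (S k).op t) ∘L HilbertTensor.map _
    refine HilbertTensor.clm_ext fun f => ?_
    simp [HilbertTensor.map_tprod, hR]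

theorem tensor_op_tprod (T : ∀ k, OpSemigroup (H k)) (t : ℝ≥0) (f : ∀ k, H k) :
    (tensor T).op t (HilbertTensor.tprod f) = HilbertTensor.tprod fun k => (T k).op t (f k) :=
  HilbertTensor.map_tprod _ f

end Tensor

end OpSemigroup

/-! ### Averaged forms and shifts -/

section Shift

variable {H E : Type*} [NormedAddCommGroup H] [InnerProductSpace ℂ H] [NormedAddCommGroup E]
  [InnerProductSpace ℂ E]

theorem isHilbertForm_intervalIntegral [CompleteSpace H] (A : ℝ → H →L[ℂ] E) {a b C : ℝ}
    (hab : a ≤ b) (hC0 : 0 ≤ C) (hA : ∀ h, ContinuousOn (fun s => A s h) (Set.Ioo a b))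
    (hC : ∀ s ∈ Set.Ioo a b, ∀ h, ‖A s h‖ ≤ C * ‖h‖) :
    IsHilbertForm fun h => ∫ s in a..b, ‖A s h‖ ^ 2 := by
  simp only [intervalIntegral.integral_of_le hab, integral_Ioc_eq_integral_Ioo]
  exact isHilbertForm_integral A hC0 hA hC

theorem intervalIntegrable_norm_sq {F : Type*} [NormedAddCommGroup F] {f : ℝ → F}
    {a b C u v : ℝ}
    (hf : ContinuousOn f (Set.Ioo a b)) (hC : ∀ s ∈ Set.Ioo a b, ‖f s‖ ≤ C) (hu : a ≤ u)
    (huv : u ≤ v) (hv : v ≤ b) : IntervalIntegrable (fun s => ‖f s‖ ^ 2) volume u v := by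
  rw [intervalIntegrable_iff_integrableOn_Ioo_of_le huv]
  exact (integrableOn_norm_sq hf hC).mono_set (Set.Ioo_subset_Ioo hu hv)

/-- Substituting s ↦ s+t and applying `hshift` moves the window from [a, b] to [a-t, b-t]; the last
two integrals record the piece gained on the left and the piece lost on the right. -/
theorem integral_norm_sq_shift_le {T : OpSemigroup H} {A : ℝ → H →L[ℂ] E} {a b C : ℝ} {τ : ℝ≥0}
    (hab : a ≤ b) (hA : ∀ h, ContinuousOn (fun s => A s h) (Set.Ioo (a - τ) b))
    (hC : ∀ s ∈ Set.Ioo (a - τ) b, ∀ h, ‖A s h‖ ≤ C * ‖h‖)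
    (hshift : ∀ t : ℝ≥0, t ≤ τ → ∀ s ∈ Set.Ioo (a - τ) (b - t), ∀ h,
      ‖A (s + t) (T.op t h)‖ ≤ ‖A s h‖) (t : ℝ≥0) (ht : t ≤ τ) (h : H) :
    ∫ s in a..b, ‖A s (T.op t h)‖ ^ 2 ≤ (∫ s in a..b, ‖A s h‖ ^ 2) +
      (∫ s in (a - t)..a, ‖A s h‖ ^ 2) - ∫ s in (b - t)..b, ‖A s h‖ ^ 2 := by
  have ht' : (t : ℝ) ≤ τ := by exact_mod_cast ht
  have ht0 : (0 : ℝ) ≤ t := t.2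
  have hi : ∀ h u v, a - τ ≤ u → u ≤ v → v ≤ b →
      IntervalIntegrable (fun s => ‖A s h‖ ^ 2) volume u v := fun h u v hu huv hv =>
    intervalIntegrable_norm_sq (hA h) (fun s hs => hC s hs h) hu huv hv
  have h1 : ∫ s in a..b, ‖A s (T.op t h)‖ ^ 2 =
      ∫ s in (a - t)..(b - t), ‖A (s + t) (T.op t h)‖ ^ 2 := by
    rw [intervalIntegral.integral_comp_add_right (fun s => ‖A s (T.op t h)‖ ^ 2)]
    simp
  have h2 : ∫ s in (a - t)..(b - t), ‖A (s + t) (T.op t h)‖ ^ 2 ≤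
      ∫ s in (a - t)..(b - t), ‖A s h‖ ^ 2 := by
    refine intervalIntegral.integral_mono_on_of_le_Ioo (by linarith) ?_
      (hi h _ _ (by linarith) (by linarith) (by linarith)) fun s hs => ?_
    · have := (hi (T.op t h) a b (by linarith) hab le_rfl).comp_add_right (t : ℝ)
      simpa using this
    · have := hshift t ht s ⟨by linarith [hs.1], hs.2⟩ h
      gcongr
  have h3 := intervalIntegral.integral_add_adjacent_intervals
    (hi h (a - t) a (by linarith) (by linarith) hab) (hi h a b (by linarith) hab le_rfl)
  have h4 := intervalIntegral.integral_add_adjacent_intervals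
    (hi h (a - t) (b - t) (by linarith) (by linarith) (by linarith))
    (hi h (b - t) b (by linarith) (by linarith) le_rfl)
  linarith

theorem integral_norm_sq_le {F : Type*} [NormedAddCommGroup F] {f : ℝ → F} {a b C : ℝ} (hab : a ≤ b)
    (hf : ContinuousOn f (Set.Ioo a b)) (hC : ∀ s ∈ Set.Ioo a b, ‖f s‖ ≤ C) :
    ∫ s in a..b, ‖f s‖ ^ 2 ≤ (b - a) * C ^ 2 := by
  have := intervalIntegral.integral_mono_on_of_le_Ioo hab
    (intervalIntegrable_norm_sq hf hC le_rfl hab le_rfl)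
    (intervalIntegrable_const (c := C ^ 2)) fun s hs => by
      have := hC s hs
      gcongr
  simpa using this

theorem le_integral_norm_sq {F : Type*} [NormedAddCommGroup F] {f : ℝ → F}
    {a b c C : ℝ} (hab : a ≤ b) (hc : 0 ≤ c)
    (hf : ContinuousOn f (Set.Ioo a b)) (hC : ∀ s ∈ Set.Ioo a b, ‖f s‖ ≤ C)
    (hcf : ∀ s ∈ Set.Ioo a b, c ≤ ‖f s‖) :
    (b - a) * c ^ 2 ≤ ∫ s in a..b, ‖f s‖ ^ 2 := by
  have := intervalIntegral.integral_mono_on_of_le_Ioo hab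
    (intervalIntegrable_const (c := c ^ 2))
    (intervalIntegrable_norm_sq hf hC le_rfl hab le_rfl) fun s hs => by
      have := hcf s hs
      gcongr
  simpa using this

/-- The averaged form N gains at most t C² ‖h‖² over time t, and the lower bound on `A` makes this
at most K t N(h). Then 1 + K t ≤ exp (K t), and the loss term is simply dropped. -/
theorem OpSemigroup.isSQC_of_shift [CompleteSpace H] {T : OpSemigroup H} {A : ℝ → H →L[ℂ] E}
    {a b c C : ℝ} {τ : ℝ≥0} (hab : a < b) (hτ : 0 < τ) (hc : 0 < c) (hC0 : 0 ≤ C)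
    (hA : ∀ h, ContinuousOn (fun s => A s h) (Set.Ioo (a - τ) b))
    (hC : ∀ s ∈ Set.Ioo (a - τ) b, ∀ h, ‖A s h‖ ≤ C * ‖h‖)
    (hcA : ∀ s ∈ Set.Ioo a b, ∀ h, c * ‖h‖ ≤ ‖A s h‖)
    (hshift : ∀ t : ℝ≥0, t ≤ τ → ∀ s ∈ Set.Ioo (a - τ) (b - t), ∀ h,
      ‖A (s + t) (T.op t h)‖ ≤ ‖A s h‖) : T.IsSQC := by
  have hτ0 : (0 : ℝ) < τ := hτ
  have hsub : Set.Ioo a b ⊆ Set.Ioo (a - τ) b := Set.Ioo_subset_Ioo (by linarith) le_rfl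
  have hba : 0 < b - a := sub_pos.2 hab
  have hlow : ∀ h, (b - a) * c ^ 2 * ‖h‖ ^ 2 ≤ ∫ s in a..b, ‖A s h‖ ^ 2 := fun h => by
    rw [mul_assoc, ← mul_pow]
    exact le_integral_norm_sq hab.le (by positivity) ((hA h).mono hsub)
      (fun s hs => hC s (hsub hs) h) fun s hs => hcA s hs h
  set K := C ^ 2 / ((b - a) * c ^ 2) with hK
  refine isSQC_iff.2 ⟨-(K / 2), isSC_rescale_of_form (c := (b - a) * c ^ 2) (τ := τ)
    (isHilbertForm_intervalIntegral A hab.le hC0 (fun h => (hA h).mono hsub)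
      fun s hs => hC s (hsub hs)) (by positivity) hlow hτ fun t _ ht h => ?_⟩
  have ht' : (t : ℝ) ≤ τ := by exact_mod_cast ht
  have ht0 : (0 : ℝ) ≤ t := t.2
  have h1 := integral_norm_sq_shift_le hab.le hA hC hshift t ht h
  have hsub' : Set.Ioo (a - t) a ⊆ Set.Ioo (a - τ) b := Set.Ioo_subset_Ioo (by linarith) hab.le
  have h2 := integral_norm_sq_le (by linarith) ((hA h).mono hsub') fun s hs => hC s (hsub' hs) h
  have h3 : 0 ≤ ∫ s in (b - t)..b, ‖A s h‖ ^ 2 :=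
    intervalIntegral.integral_nonneg (by linarith) fun s _ => by positivity
  have h4 : C ^ 2 * ‖h‖ ^ 2 ≤ K * ∫ s in a..b, ‖A s h‖ ^ 2 := by
    calc C ^ 2 * ‖h‖ ^ 2 = K * ((b - a) * c ^ 2 * ‖h‖ ^ 2) := by
          rw [hK]
          field_simp
      _ ≤ _ := by
          gcongr
          exact hlow h
  have hN : 0 ≤ ∫ s in a..b, ‖A s h‖ ^ 2 := le_trans (by positivity) (hlow h)
  have h5 := mul_le_mul_of_nonneg_right (Real.add_one_le_exp (2 * (K / 2) * t)) hN
  have h6 := mul_le_mul_of_nonneg_left h4 ht0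
  rw [show a - (a - (t : ℝ)) = t by ring, mul_pow] at h2
  rw [show 2 * (K / 2) * (t : ℝ) = K * t by ring] at h5 ⊢
  linarith

end Shift

/-! ### Slots of the tensor product -/

namespace OpSemigroup

variable {ι : Type*} [Fintype ι] [DecidableEq ι] {H : ι → Type*} [∀ k, NormedAddCommGroup (H k)]
  [∀ k, InnerProductSpace ℂ (H k)]

/-- The operator `h ↦ R (⨂ k, T k (s) (x k))` with the `j`-th factor replaced by `h`. -/
def slot (R : HilbertTensor H ≃L[ℂ] HilbertTensor H) (T : ∀ k, OpSemigroup (H k))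
    (x : ∀ k, H k) (j : ι) (s : ℝ) : H j →L[ℂ] HilbertTensor H :=
  (R : HilbertTensor H →L[ℂ] HilbertTensor H) ∘L
    (HilbertTensor.tprodL H).toContinuousLinearMap (fun k => (T k).opR s (x k)) j

variable {R : HilbertTensor H ≃L[ℂ] HilbertTensor H} {T : ∀ k, OpSemigroup (H k)} {x : ∀ k, H k}
  {j : ι}

theorem slot_apply (s : ℝ) (h : H j) : slot R T x j s h =
    R (HilbertTensor.tprod (Function.update (fun k => (T k).opR s (x k)) j h)) := rfl

theorem norm_tprod_update (f : ∀ k, H k) (h : H j) :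
    ‖HilbertTensor.tprod (Function.update f j h)‖ = (∏ k ∈ Finset.univ.erase j, ‖f k‖) * ‖h‖ := by
  rw [HilbertTensor.norm_tprod, ← Finset.prod_erase_mul _ _ (Finset.mem_univ j)]
  congr 1
  · refine Finset.prod_congr rfl fun k hk => ?_
    rw [Function.update_of_ne (Finset.ne_of_mem_erase hk)]
  · rw [Function.update_self]

theorem norm_slot_le {C : ℝ} {s : ℝ}
    (hC : ∏ k ∈ Finset.univ.erase j, ‖(T k).opR s (x k)‖ ≤ C) (h : H j) :
    ‖slot R T x j s h‖ ≤ ‖(R : HilbertTensor H →L[ℂ] HilbertTensor H)‖ * C * ‖h‖ := by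
  rw [slot_apply, mul_assoc]
  refine (R : HilbertTensor H →L[ℂ] HilbertTensor H).le_opNorm_of_le ?_
  rw [norm_tprod_update]
  gcongr

theorem le_norm_slot {c : ℝ} {s : ℝ}
    (hc : c ≤ ∏ k ∈ Finset.univ.erase j, ‖(T k).opR s (x k)‖) (h : H j) :
    c / (‖(R.symm : HilbertTensor H →L[ℂ] HilbertTensor H)‖ + 1) * ‖h‖ ≤ ‖slot R T x j s h‖ := by
  rw [div_mul_eq_mul_div, div_le_iff₀ (by positivity), slot_apply]
  set z := HilbertTensor.tprod (Function.update (fun k => (T k).opR s (x k)) j h)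
  calc c * ‖h‖ ≤ (∏ k ∈ Finset.univ.erase j, ‖(T k).opR s (x k)‖) * ‖h‖ := by gcongr
    _ = ‖z‖ := (norm_tprod_update _ _).symm
    _ = ‖(R.symm : HilbertTensor H →L[ℂ] HilbertTensor H) (R z)‖ := by simp
    _ ≤ ‖(R.symm : HilbertTensor H →L[ℂ] HilbertTensor H)‖ * ‖R z‖ :=
        ContinuousLinearMap.le_opNorm _ _
    _ ≤ ‖R z‖ * (‖(R.symm : HilbertTensor H →L[ℂ] HilbertTensor H)‖ + 1) := by
        nlinarith [norm_nonneg (R z)]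

/-- The tensor semigroup at time `t` advances the frozen factors from time s to s+t and applies `T
j` to `h`, so this is its contractivity in the norm ‖R ·‖. -/
theorem norm_slot_shift_le (hR : ∀ t z, ‖R ((tensor T).op t z)‖ ≤ ‖R z‖) {s : ℝ} (hs : 0 ≤ s)
    (t : ℝ≥0) (h : H j) : ‖slot R T x j (s + t) ((T j).op t h)‖ ≤ ‖slot R T x j s h‖ := by
  rw [slot_apply, slot_apply]
  refine le_of_eq_of_le ?_ (hR t _)
  rw [tensor_op_tprod]
  congr 3
  ext k
  rcases eq_or_ne k j with rfl | hk
  · simp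
  · rw [Function.update_of_ne hk, Function.update_of_ne hk, add_comm, opR_add _ t.coe_nonneg hs, opR_coe]

theorem continuousOn_slot (hT : ∀ k, (T k).StronglyContinuousOnIoi) (h : H j) :
    ContinuousOn (fun s => slot R T x j s h) (Set.Ioi 0) := by
  simp only [slot_apply]
  refine R.continuous.comp_continuousOn
    ((HilbertTensor.tprodL H).cont.comp_continuousOn (continuousOn_pi.2 fun k => ?_))
  rcases eq_or_ne k j with rfl | hk
  · simpa using continuousOn_const
  · simp only [Function.update_of_ne hk]
    exact (hT k).opR _

/-- If T(s) = 0, then T(t) = T(t-s) T(s) = 0 for every t ≥ s, so a nonzero T(t) excludes all s in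
(0, t). -/
theorem IsNonzero.eventually {H : Type*} [NormedAddCommGroup H] [InnerProductSpace ℂ H]
    {T : OpSemigroup H} (hT : T.IsNonzero) : ∀ᶠ s in 𝓝[>] (0 : ℝ), T.opR s ≠ 0 := by
  obtain ⟨t, ht, h⟩ := hT
  filter_upwards [Ioo_mem_nhdsGT (show (0 : ℝ) < t from ht)] with s hs h0
  refine h ?_
  ext z
  rw [← opR_coe, ← sub_add_cancel (t : ℝ) s, opR_add _ (by linarith [hs.2]) hs.1.le, h0]
  simp

theorem isSQC_of_isSC_tensor [∀ k, CompleteSpace (H k)] (hT : ∀ k, (T k).StronglyContinuousOnIoi)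
    (hT0 : ∀ k, (T k).IsNonzero) (h : (tensor T).IsSC) (j : ι) : (T j).IsSQC := by
  obtain ⟨R, hR⟩ := isSC_iff.1 h
  obtain ⟨σ, hσ, hσ0⟩ : ∃ σ : ℝ, (∀ k, (T k).opR σ ≠ 0) ∧ 0 < σ :=
    ((eventually_all.2 fun k => (hT0 k).eventually).and
      (self_mem_nhdsWithin : Set.Ioi (0 : ℝ) ∈ 𝓝[>] 0)).exists
  have hx : ∀ k, ∃ y, (T k).opR σ y ≠ 0 := fun k => by
    by_contra! hcon
    exact hσ k (ContinuousLinearMap.ext hcon)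
  -- Since T_k(σ) x_k ≠ 0, no T_k(s) x_k with 0 ≤ s ≤ σ vanishes; by compactness the product of
  -- their norms has positive bounds from both sides on [σ/4, σ].
  choose x hx using hx
  have hcont : ContinuousOn (fun s => ∏ k ∈ Finset.univ.erase j, ‖(T k).opR s (x k)‖)
      (Set.Icc (σ / 4) σ) :=
    continuousOn_finsetProd _ fun k _ => (((hT k).opR (x k)).mono fun s hs =>
      lt_of_lt_of_le (by positivity) hs.1).norm
  have hne : (Set.Icc (σ / 4) σ).Nonempty := Set.nonempty_Icc.2 (by linarith)
  obtain ⟨s₀, hs₀, hmin⟩ := isCompact_Icc.exists_isMinOn hne hcont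
  obtain ⟨s₁, hs₁, hmax⟩ := isCompact_Icc.exists_isMaxOn hne hcont
  have hpos : 0 < ∏ k ∈ Finset.univ.erase j, ‖(T k).opR s₀ (x k)‖ := by
    refine Finset.prod_pos fun k _ => norm_pos_iff.2 fun h0 => hx k ?_
    rw [← sub_add_cancel σ s₀, opR_add _ (by linarith [hs₀.2]) (by linarith [hs₀.1]), h0, map_zero]
  have hτ : (((σ / 4).toNNReal : ℝ≥0) : ℝ) = σ / 4 := Real.coe_toNNReal _ (by positivity)
  -- Averaging over [σ/2, σ] with shifts up to σ/4 keeps every time used inside (σ/4, σ).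
  refine isSQC_of_shift (A := slot R T x j) (a := σ / 2) (b := σ) (τ := (σ / 4).toNNReal)
    (by linarith) (by simpa using hσ0) (div_pos hpos (by positivity)) ?_
    (fun h => (continuousOn_slot hT h).mono fun s hs => ?_) (fun s hs => norm_slot_le (hmax ?_))
    (fun s hs => le_norm_slot (hmin ?_)) (fun t ht s hs => norm_slot_shift_le hR ?_ t)
  · exact mul_nonneg (norm_nonneg _) (Finset.prod_nonneg fun k _ => norm_nonneg _)
  · rw [hτ] at hs
    exact (by linarith [hs.1] : (0 : ℝ) < s)
  · rw [hτ] at hs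
    exact ⟨by linarith [hs.1], hs.2.le⟩
  · exact ⟨by linarith [hs.1], hs.2.le⟩
  · rw [hτ] at hs
    linarith [hs.1]

end OpSemigroup

/-! ### Quasi-contractive and exponentially stable semigroups -/

theorem le_norm_equiv_apply {H : Type*} [NormedAddCommGroup H] [InnerProductSpace ℂ H]
    (R : H ≃L[ℂ] H) (h : H) : 1 / (‖(R.symm : H →L[ℂ] H)‖ + 1) * ‖h‖ ≤ ‖R h‖ := by
  rw [div_mul_eq_mul_div, div_le_iff₀ (by positivity), one_mul]
  calc ‖h‖ = ‖(R.symm : H →L[ℂ] H) (R h)‖ := by simp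
    _ ≤ ‖(R.symm : H →L[ℂ] H)‖ * ‖R h‖ := ContinuousLinearMap.le_opNorm _ _
    _ ≤ ‖R h‖ * (‖(R.symm : H →L[ℂ] H)‖ + 1) := by nlinarith [norm_nonneg (R h)]

namespace OpSemigroup

variable {H : Type*} [NormedAddCommGroup H] [InnerProductSpace ℂ H]

theorem IsSQC.exists_exp_bound {T : OpSemigroup H} (hT : T.IsSQC) :
    ∃ (R : H ≃L[ℂ] H) (a : ℝ), 0 ≤ a ∧
      ∀ s, 0 ≤ s → ∀ h, ‖R (T.opR s h)‖ ≤ Real.exp (a * s) * ‖R h‖ := by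
  obtain ⟨a, ha⟩ := isSQC_iff.1 hT
  obtain ⟨R, hR⟩ := isSC_iff.1 ha
  -- A nonnegative rate makes the exponential bound monotone in time.
  refine ⟨R, |a|, abs_nonneg a, fun s hs h => ?_⟩
  lift s to ℝ≥0 using hs
  rw [opR_coe]
  have h1 := hR s h
  rw [rescale_apply, R.map_smul, norm_smul, Complex.norm_real,
    Real.norm_of_nonneg (Real.exp_pos _).le] at h1
  calc ‖R (T.op s h)‖ = Real.exp (-a * s) * (Real.exp (a * s) * ‖R (T.op s h)‖) := by
        rw [← mul_assoc, ← Real.exp_add]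
        simp
    _ ≤ Real.exp (|a| * s) * ‖R h‖ := by
        gcongr
        exact neg_le_abs a

/-- The contracted form is ‖R h‖² + K ∫_0^L ‖R T(u) h‖² du, with L so large that T(L) at least
halves the norm ‖R ·‖. Over time t the integral loses J, its part over u in (0, t), and regains at
most J/4 beyond L. The net loss 3KJ/4 pays for the possible growth of ‖R h‖². -/
theorem isSC_of_isSQC_of_norm_lt_one [CompleteSpace H] {T : OpSemigroup H}
    (hT : T.StronglyContinuousOnIoi) (hQ : T.IsSQC) {n : ℕ} (hn : n ≠ 0) (hlt : ‖T.op n‖ < 1) :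
    T.IsSC := by
  obtain ⟨R, a, ha, hR⟩ := hQ.exists_exp_bound
  set ρ := ‖(R : H →L[ℂ] H)‖
  set ρ' := ‖(R.symm : H →L[ℂ] H)‖
  obtain ⟨L, hL, hLR⟩ : ∃ L : ℝ, 0 < L ∧ ∀ h, ‖R (T.opR L h)‖ ≤ 1 / 2 * ‖R h‖ := by
    have hlim : Tendsto (fun k : ℕ => ρ * (‖T.op n‖ ^ k * ρ')) atTop (𝓝 (ρ * (0 * ρ'))) :=
      ((tendsto_pow_atTop_nhds_zero_of_lt_one (norm_nonneg _) hlt).mul_const _).const_mul _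
    rw [zero_mul, mul_zero] at hlim
    obtain ⟨k, hk, hk0⟩ := ((hlim.eventually (gt_mem_nhds (by norm_num : (0 : ℝ) < 1 / 2))).and
      (eventually_gt_atTop 0)).exists
    refine ⟨((n * k : ℕ) : ℝ≥0), by positivity, fun h => ?_⟩
    rw [opR_coe]
    have hop : T.op (n * k : ℕ) = T.op n ^ k := by
      rw [op_natCast, op_natCast, pow_mul]
    calc ‖R (T.op (n * k : ℕ) h)‖ ≤ ρ * (‖T.op n ^ k‖ * (ρ' * ‖R h‖)) := by
          rw [hop]
          refine (R : H →L[ℂ] H).le_opNorm_of_le ((T.op n ^ k).le_opNorm_of_le ?_)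
          simpa using (R.symm : H →L[ℂ] H).le_opNorm (R h)
      _ ≤ ρ * (‖T.op n‖ ^ k * (ρ' * ‖R h‖)) := by
          gcongr
          exact norm_pow_le' _ hk0
      _ = ρ * (‖T.op n‖ ^ k * ρ') * ‖R h‖ := by ring
      _ ≤ 1 / 2 * ‖R h‖ := by gcongr
  -- Time is reversed so that A(s+t) T(t) = A(s), which is the shift hypothesis with equality.
  let A : ℝ → H →L[ℂ] H := fun s => (R : H →L[ℂ] H) ∘L T.opR (L - s)
  have hAapp : ∀ s h, A s h = R (T.opR (L - s) h) := fun s h => rfl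
  set C := Real.exp (a * (L + 1)) * ρ
  have hC0 : 0 ≤ C := by positivity
  have hcont : ∀ h, ContinuousOn (fun s => A s h) (Set.Ioo (0 - (1 : ℝ≥0)) L) := fun h =>
    R.continuous.comp_continuousOn ((hT.opR h).comp (by fun_prop) fun s hs => sub_pos.2 hs.2)
  have hbd : ∀ s ∈ Set.Ioo (0 - ((1 : ℝ≥0) : ℝ)) L, ∀ h, ‖A s h‖ ≤ C * ‖h‖ := fun s hs h => by
    rw [NNReal.coe_one] at hs
    calc ‖A s h‖ ≤ Real.exp (a * (L - s)) * ‖R h‖ := hR _ (by linarith [hs.2]) h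
      _ ≤ Real.exp (a * (L + 1)) * (ρ * ‖h‖) := by
          gcongr
          · linarith [hs.1]
          · exact (R : H →L[ℂ] H).le_opNorm h
      _ = C * ‖h‖ := by ring
  have hsub : ∀ u v : ℝ, -1 ≤ u → v ≤ L → Set.Ioo u v ⊆ Set.Ioo (0 - ((1 : ℝ≥0) : ℝ)) L :=
    fun u v hu hv => Set.Ioo_subset_Ioo (by simpa using hu) hv
  have hint : ∀ h u v, -1 ≤ u → u ≤ v → v ≤ L →
      IntervalIntegrable (fun s => ‖A s h‖ ^ 2) volume u v := fun h u v hu huv hv =>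
    intervalIntegrable_norm_sq (hcont h) (fun s hs => hbd s hs h) (by simpa using hu) huv hv
  have hshift : ∀ t : ℝ≥0, t ≤ 1 → ∀ s ∈ Set.Ioo (0 - ((1 : ℝ≥0) : ℝ)) (L - t), ∀ h,
      ‖A (s + t) (T.op t h)‖ ≤ ‖A s h‖ := fun t _ s hs h => by
    rw [hAapp, hAapp, ← T.opR_coe t, ← opR_add _ (by linarith [hs.2]) t.coe_nonneg]
    apply le_of_eq
    congr 4
    ring
  -- Chosen so that 3K/4 = 2a exp (2a), which bounds (exp (2at) − 1)/t for 0 < t ≤ 1.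
  set K := 4 / 3 * (2 * a * Real.exp (2 * a))
  have hK : 0 ≤ K := by positivity
  refine isSC_of_form (N := fun h => ‖R h‖ ^ 2 + K * ∫ s in (0 : ℝ)..L, ‖A s h‖ ^ 2)
    (c := (1 / (ρ' + 1)) ^ 2) (τ := 1)
    ((isHilbertForm_norm_sq (R : H →L[ℂ] H)).add
      ((isHilbertForm_intervalIntegral A hL.le hC0
        (fun h => (hcont h).mono (hsub _ _ (by norm_num) le_rfl))
        fun s hs => hbd s (hsub _ _ (by norm_num) le_rfl hs)).const_mul hK))
    (by positivity) (fun h => ?_) one_pos fun t ht0 ht h => ?_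
  · have h1 : (1 / (ρ' + 1) * ‖h‖) ^ 2 ≤ ‖R h‖ ^ 2 := by
      have := le_norm_equiv_apply R h
      gcongr
    have h2 : 0 ≤ ∫ s in (0 : ℝ)..L, ‖A s h‖ ^ 2 :=
      intervalIntegral.integral_nonneg hL.le fun s _ => by positivity
    rw [mul_pow] at h1
    have := mul_nonneg hK h2
    linarith
  have ht' : (t : ℝ) ≤ 1 := by exact_mod_cast ht
  have htp : (0 : ℝ) < t := ht0
  have h1 := integral_norm_sq_shift_le hL.le hcont hbd hshift t ht h
  set J := ∫ s in (L - t)..L, ‖A s h‖ ^ 2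
  have h2 : ∫ s in (0 - (t : ℝ))..0, ‖A s h‖ ^ 2 ≤ 1 / 4 * J := by
    rw [← intervalIntegral.integral_const_mul]
    have hcomp : ∫ s in (L - t)..L, ‖A (s - L) h‖ ^ 2 = ∫ s in (0 - (t : ℝ))..0, ‖A s h‖ ^ 2 := by
      rw [intervalIntegral.integral_comp_sub_right (fun s => ‖A s h‖ ^ 2)]
      congr 1 <;> ring
    rw [← hcomp]
    refine intervalIntegral.integral_mono_on_of_le_Ioo (by linarith) ?_
      ((hint h _ _ (by linarith) (by linarith) le_rfl).const_mul _) fun s hs => ?_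
    · have := (hint h (0 - t) 0 (by linarith) (by linarith) hL.le).comp_sub_right L
      convert this using 1 <;> ring
    · have h3 : ‖A (s - L) h‖ ≤ 1 / 2 * ‖A s h‖ := by
        rw [hAapp, hAapp]
        have := hLR (T.opR (L - s) h)
        rwa [← opR_add _ hL.le (by linarith [hs.2]), show L + (L - s) = L - (s - L) by ring] at this
      calc ‖A (s - L) h‖ ^ 2 ≤ (1 / 2 * ‖A s h‖) ^ 2 := by gcongr
        _ = _ := by ring
  set E := Real.exp (a * t)
  have hE : 0 < E := Real.exp_pos _
  -- For 0 ≤ u ≤ t, passing from T(u)h to T(t)h costs at most the factor E, so every integrand of J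
  -- is at least the square on the left.
  have h3 : t * (‖R (T.op t h)‖ / E) ^ 2 ≤ J := by
    have := le_integral_norm_sq (f := fun s => A s h) (a := L - t) (b := L)
      (c := ‖R (T.op t h)‖ / E) (by linarith) (by positivity)
      ((hcont h).mono (hsub _ _ (by linarith) le_rfl))
      (fun s hs => hbd s (hsub _ _ (by linarith) le_rfl hs) h) fun s hs => by
        rw [div_le_iff₀ hE, hAapp, mul_comm]
        have h4 := hR (t - (L - s)) (by linarith [hs.1]) (T.opR (L - s) h)
        rw [← opR_add _ (by linarith [hs.1]) (by linarith [hs.2]), sub_add_cancel, opR_coe] at h4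
        refine h4.trans ?_
        gcongr
        exact Real.exp_le_exp.2 (mul_le_mul_of_nonneg_left (by linarith [hs.2]) ha)
    rwa [sub_sub_cancel] at this
  have h4 : (‖R (T.op t h)‖ / E) ^ 2 ≤ ‖R h‖ ^ 2 := by
    have := hR t t.coe_nonneg h
    rw [opR_coe] at this
    have h5 : ‖R (T.op t h)‖ / E ≤ ‖R h‖ := by rwa [div_le_iff₀ hE, mul_comm]
    gcongr
  have h5 : E ^ 2 - 1 ≤ t * (3 / 4 * K) := by
    have hE2 : E ^ 2 = Real.exp (2 * a * t) := by
      rw [← Real.exp_nat_mul]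
      congr 1
      push_cast
      ring
    have h6 : Real.exp (2 * a * t) ≤ Real.exp (2 * a) :=
      Real.exp_le_exp.2 (mul_le_of_le_one_right (by positivity) ht')
    have h7 : 1 - 2 * a * t ≤ Real.exp (-(2 * a * t)) := by
      linarith [Real.add_one_le_exp (-(2 * a * t))]
    have h8 : Real.exp (2 * a * t) * (1 - 2 * a * t) ≤ 1 := by
      calc _ ≤ Real.exp (2 * a * t) * Real.exp (-(2 * a * t)) := by gcongr
        _ = 1 := by rw [← Real.exp_add]; simp
    have h9 : 2 * a * t * Real.exp (2 * a * t) ≤ 2 * a * t * Real.exp (2 * a) := by gcongr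
    calc E ^ 2 - 1 ≤ 2 * a * t * Real.exp (2 * a) := by rw [hE2]; linarith
      _ = t * (3 / 4 * K) := by ring
  have h6 : ‖R (T.op t h)‖ ^ 2 ≤ ‖R h‖ ^ 2 + 3 / 4 * K * J := by
    set y := ‖R (T.op t h)‖ / E
    have hy : ‖R (T.op t h)‖ = E * y := by
      rw [mul_div_cancel₀ _ hE.ne']
    calc ‖R (T.op t h)‖ ^ 2 = y ^ 2 + (E ^ 2 - 1) * y ^ 2 := by rw [hy]; ring
      _ ≤ ‖R h‖ ^ 2 + t * (3 / 4 * K) * y ^ 2 := by gcongr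
      _ = ‖R h‖ ^ 2 + 3 / 4 * K * (t * y ^ 2) := by ring
      _ ≤ _ := by gcongr
  have h7 := mul_le_mul_of_nonneg_left h1 hK
  have h8 := mul_le_mul_of_nonneg_left h2 hK
  linarith

end OpSemigroup

/-! ### Approximate eigenvectors -/

section ApproxEigenvector

variable {H : Type*} [NormedAddCommGroup H] [InnerProductSpace ℂ H]

/-- `x` is a sequence of approximate unit eigenvectors of `A` for the eigenvalue `μ`. -/
structure IsApproxEigenvector (A : H →L[ℂ] H) (μ : ℂ) (x : ℕ → H) : Prop where
  norm_eq : ∀ n, ‖x n‖ = 1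
  tendsto : Tendsto (fun n => ‖A (x n) - μ • x n‖) atTop (𝓝 0)

theorem IsApproxEigenvector.pow {A : H →L[ℂ] H} {μ : ℂ} {x : ℕ → H}
    (h : IsApproxEigenvector A μ x) (k : ℕ) : IsApproxEigenvector (A ^ k) (μ ^ k) x := by
  refine ⟨h.norm_eq, ?_⟩
  induction k with
  | zero => simp
  | succ k ih =>
    have hlim := (h.tendsto.const_mul ‖A ^ k‖).add (ih.const_mul ‖μ‖)
    rw [mul_zero, mul_zero, add_zero] at hlim
    refine squeeze_zero (fun _ => norm_nonneg _) (fun n => ?_) hlim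
    have heq : (A ^ (k + 1)) (x n) - μ ^ (k + 1) • x n =
        (A ^ k) (A (x n) - μ • x n) + μ • ((A ^ k) (x n) - μ ^ k • x n) := by
      rw [map_sub, map_smul, smul_sub, smul_smul, ← pow_succ', pow_succ A, mul_apply_eq_comp]
      abel
    rw [heq]
    refine (norm_add_le _ _).trans (add_le_add ((A ^ k).le_opNorm _) ?_)
    rw [norm_smul]

/-- An operator whose spectral radius is one has approximate eigenvectors for a unimodular
eigenvalue. -/
theorem exists_isApproxEigenvector [CompleteSpace H] (A : H →L[ℂ] H) (h1 : ∀ n, 1 ≤ ‖A ^ n‖)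
    (h2 : ∀ d < 0, ∃ n : ℕ, n ≠ 0 ∧ Real.exp (d * n) * ‖A ^ n‖ < 1) :
    ∃ μ x, ‖μ‖ = 1 ∧ IsApproxEigenvector A μ x := by
  have hnt : Nontrivial (H →L[ℂ] H) := by
    refine ⟨1, 0, fun h => ?_⟩
    have := h1 0
    rw [pow_zero, h, norm_zero] at this
    linarith
  have hH : Nontrivial H := by
    by_contra hcon
    rw [not_nontrivial_iff_subsingleton] at hcon
    exact not_subsingleton (H →L[ℂ] H) inferInstance
  -- Hypothesis `h2` with d = −log ‖z‖ would give ‖A^n‖ < ‖z‖^n for some n ≥ 1, against z^n lying in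
  -- the spectrum of A^n.
  have hle : ∀ z ∈ spectrum ℂ A, ‖z‖ ≤ 1 := by
    intro z hz
    by_contra! hcon
    obtain ⟨n, hn, hlt⟩ := h2 (-Real.log ‖z‖) (neg_neg_of_pos (Real.log_pos hcon))
    have hpow := spectrum.norm_le_norm_of_mem (spectrum.pow_mem_pow A n hz)
    rw [norm_pow] at hpow
    have hexp : Real.exp (-Real.log ‖z‖ * n) = (‖z‖ ^ n)⁻¹ := by
      rw [mul_comm, Real.exp_nat_mul, Real.exp_neg, Real.exp_log (by linarith), inv_pow]
    rw [hexp, inv_mul_lt_one₀ (by positivity)] at hlt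
    linarith
  obtain ⟨μ, hμ, hμr⟩ := spectrum.exists_nnnorm_eq_spectralRadius A
  have hge : 1 ≤ spectralRadius ℂ A := by
    refine ge_of_tendsto' (spectrum.pow_nnnorm_pow_one_div_tendsto_nhds_spectralRadius A)
      fun n => ?_
    have h3 : (1 : ENNReal) ≤ ‖A ^ n‖₊ := by exact_mod_cast h1 n
    simpa using ENNReal.rpow_le_rpow h3 (by positivity : (0 : ℝ) ≤ 1 / n)
  have hμ1 : ‖μ‖ = 1 := le_antisymm (hle μ hμ) (by
    rw [← hμr] at hge
    exact_mod_cast hge)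
  suffices h : ∀ n : ℕ, ∃ x : H, ‖x‖ = 1 ∧ ‖A x - μ • x‖ ≤ 1 / ((n : ℝ) + 1) by
    choose x hx hxA using h
    exact ⟨μ, x, hμ1, hx, squeeze_zero (fun _ => norm_nonneg _) hxA
      tendsto_one_div_add_atTop_nhds_zero_nat⟩
  -- A spectral point of modulus one is a boundary point of the spectrum. If A − μ were bounded
  -- below by c, then z = (1 + c/4)μ, which lies off the spectrum, would have a resolvent of norm at
  -- most 2/c; as |z − μ| = c/4 < c/2, μ would be off the spectrum too.
  by_contra! hcon
  obtain ⟨n, hn⟩ := hcon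
  set c : ℝ := 1 / ((n : ℝ) + 1)
  have hc : 0 < c := by positivity
  have hlow : ∀ x, c * ‖x‖ ≤ ‖A x - μ • x‖ := by
    intro x
    rcases eq_or_ne x 0 with rfl | hx
    · simp
    have hx0 : 0 < ‖x‖ := norm_pos_iff.2 hx
    have := hn (((‖x‖⁻¹ : ℝ) : ℂ) • x) (by
      rw [norm_smul, Complex.norm_real, norm_inv, norm_norm, inv_mul_cancel₀ hx0.ne'])
    rw [map_smul, smul_comm, ← smul_sub, norm_smul, Complex.norm_real, norm_inv, norm_norm,
      lt_inv_mul_iff₀ hx0] at this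
    linarith
  set z : ℂ := ((1 + c / 4 : ℝ) : ℂ) * μ
  have hz : ‖z - μ‖ = c / 4 := by
    have : z - μ = ((c / 4 : ℝ) : ℂ) * μ := by
      simp only [z]
      push_cast
      ring
    rw [this, norm_mul, hμ1, mul_one, Complex.norm_real, Real.norm_of_nonneg (by positivity)]
  have hzs : z ∉ spectrum ℂ A := fun hmem => by
    have := hle z hmem
    rw [norm_mul, hμ1, mul_one, Complex.norm_real, Real.norm_of_nonneg (by positivity)] at this
    linarith
  rw [spectrum.notMem_iff] at hzs
  obtain ⟨u, hu⟩ := hzs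
  have hu1 : ∀ x, c / 2 * ‖x‖ ≤ ‖(u : H →L[ℂ] H) x‖ := fun x => by
    have hux : (u : H →L[ℂ] H) x = (z - μ) • x - (A x - μ • x) := by
      rw [hu, sub_apply, Algebra.algebraMap_eq_smul_one, smul_apply, one_apply_eq_self, sub_smul]
      abel
    have h3 := norm_sub_norm_le (A x - μ • x) ((z - μ) • x)
    rw [norm_sub_rev (A x - μ • x), ← hux, norm_smul, hz] at h3
    have := hlow x
    nlinarith [norm_nonneg x]
  have hinv : ‖((u⁻¹ : (H →L[ℂ] H)ˣ) : H →L[ℂ] H)‖ ≤ 2 / c := by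
    refine ContinuousLinearMap.opNorm_le_bound _ (by positivity) fun x => ?_
    have h3 := hu1 (((u⁻¹ : (H →L[ℂ] H)ˣ) : H →L[ℂ] H) x)
    rw [← mul_apply_eq_comp, Units.mul_inv, one_apply_eq_self] at h3
    rw [div_mul_eq_mul_div, le_div_iff₀ hc]
    linarith
  have hlt : ‖(algebraMap ℂ (H →L[ℂ] H) (μ - z))‖ < ‖((u⁻¹ : (H →L[ℂ] H)ˣ) : H →L[ℂ] H)‖⁻¹ := by
    rw [norm_algebraMap', norm_sub_rev, hz]
    have hpos : 0 < ‖((u⁻¹ : (H →L[ℂ] H)ˣ) : H →L[ℂ] H)‖ := norm_pos_iff.2 (Units.ne_zero _)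
    rw [lt_inv_comm₀ (by positivity) hpos]
    refine hinv.trans_lt ?_
    rw [inv_div]
    gcongr
    norm_num
  refine hμ ⟨Units.add u _ hlt, ?_⟩
  rw [Units.val_add, hu, map_sub]
  abel

end ApproxEigenvector

/-! ### Critical semigroups -/

namespace OpSemigroup

variable {ι : Type*} [Fintype ι] [DecidableEq ι] {H : ι → Type*} [∀ k, NormedAddCommGroup (H k)]
  [∀ k, InnerProductSpace ℂ (H k)]

/-- Unimodular factors in the slots other than `j` come out as one scalar of modulus one, so
approximate eigenvalues leave no trace in the norm. -/
theorem norm_equiv_tprod_update_smul (R : HilbertTensor H ≃L[ℂ] HilbertTensor H) {μ : ι → ℂ}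
    (hμ : ∀ k, ‖μ k‖ = 1) (f : ∀ k, H k) (j : ι) (h : H j) :
    ‖R (HilbertTensor.tprod (Function.update (fun k => μ k • f k) j h))‖ =
      ‖R (HilbertTensor.tprod (Function.update f j h))‖ := by
  have hν : ∀ k, ‖Function.update μ j 1 k‖ = 1 := fun k => by
    rcases eq_or_ne k j with rfl | hk
    · simp
    · rw [Function.update_of_ne hk, hμ]
  have heq : Function.update (fun k => μ k • f k) j h =
      fun k => Function.update μ j 1 k • Function.update f j h k := by
    ext k
    rcases eq_or_ne k j with rfl | hk
    · simp
    · simp [Function.update_of_ne hk]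
  have h1 : HilbertTensor.tprod (Function.update (fun k => μ k • f k) j h) =
      (∏ k, Function.update μ j 1 k) • HilbertTensor.tprod (Function.update f j h) := by
    rw [heq]
    exact (HilbertTensor.tprodL H).map_smul_univ _ _
  rw [h1, R.map_smul, norm_smul, norm_prod, Finset.prod_congr rfl fun k _ => hν k]
  simp

theorem abs_norm_tprod_update_sub_le (R : HilbertTensor H ≃L[ℂ] HilbertTensor H) {μ : ι → ℂ}
    (hμ : ∀ k, ‖μ k‖ = 1) {p q : ∀ k, H k} {M δ : ℝ} (hδ : 0 ≤ δ) (hp : ∀ k, ‖p k‖ ≤ M)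
    (hq : ∀ k, ‖q k‖ ≤ M) (hpq : ∀ k, ‖q k - μ k • p k‖ ≤ δ) (j : ι) (h : H j) :
    |‖R (HilbertTensor.tprod (Function.update p j h))‖ -
      ‖R (HilbertTensor.tprod (Function.update q j h))‖| ≤
      ‖(R : HilbertTensor H →L[ℂ] HilbertTensor H)‖ *
        (Fintype.card ι * (M + ‖h‖) ^ (Fintype.card ι - 1) * δ) := by
  have hM : 0 ≤ M := (norm_nonneg _).trans (hp j)
  rw [← norm_equiv_tprod_update_smul R hμ p j h]
  refine (abs_norm_sub_norm_le _ _).trans ?_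
  rw [← map_sub]
  refine (R : HilbertTensor H →L[ℂ] HilbertTensor H).le_opNorm_of_le ?_
  rw [norm_sub_rev]
  have key := (HilbertTensor.tprodL H).toMultilinearMap.norm_image_sub_le_of_bound (C := 1)
    zero_le_one (fun f => by rw [one_mul]; exact (HilbertTensor.norm_tprod f).le)
    (Function.update q j h) (Function.update (fun k => μ k • p k) j h)
  refine key.trans ?_
  rw [one_mul]
  have hbd : ∀ f : ∀ k, H k, (∀ k, ‖f k‖ ≤ M) → ‖Function.update f j h‖ ≤ M + ‖h‖ := fun f hf => by
    refine (pi_norm_le_iff_of_nonneg (by positivity)).2 fun k => ?_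
    rcases eq_or_ne k j with rfl | hk
    · simpa using hM
    · rw [Function.update_of_ne hk]
      linarith [hf k, norm_nonneg h]
  gcongr
  · exact max_le (hbd q hq) (hbd _ fun k => by rw [norm_smul, hμ, one_mul]; exact hp k)
  · refine (pi_norm_le_iff_of_nonneg hδ).2 fun k => ?_
    rcases eq_or_ne k j with rfl | hk
    · simpa using hδ
    · simpa [Function.update_of_ne hk] using hpq k

/-- Because T_k(s+1) x_k ≈ μ_k T_k(s) x_k with |μ_k| = 1, ‖A(s+1)h‖ and ‖A(s)h‖ nearly agree.
Averaging over the unit interval [1, 2] makes the gain on (1-t, 1) match the loss on (2-t, 2) up to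
an error that vanishes in the limit. -/
theorem isSC_of_isSC_tensor_of_isApproxEigenvector [∀ k, CompleteSpace (H k)]
    {T : ∀ k, OpSemigroup (H k)} (hT : ∀ k, (T k).StronglyContinuousOnIoi)
    (hSC : (tensor T).IsSC) {μ : ι → ℂ} {x : ∀ k, ℕ → H k} (hμ : ∀ k, ‖μ k‖ = 1)
    (hx : ∀ k, IsApproxEigenvector ((T k).op 1) (μ k) (x k)) (j : ι) : (T j).IsSC := by
  obtain ⟨R, hR⟩ := isSC_iff.1 hSC
  choose M₀ hM₀ hTM₀ using fun k => (hT k).exists_bound (by norm_num : (0 : ℝ) < 1 / 2) 3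
  set M : ℝ := 1 + ∑ k, M₀ k
  have hM : 0 < M := add_pos_of_pos_of_nonneg one_pos (Finset.sum_nonneg fun k _ => (hM₀ k).le)
  have hTM : ∀ k, ∀ s ∈ Set.Icc (1 / 2 : ℝ) 3, ∀ h, ‖(T k).opR s h‖ ≤ M * ‖h‖ :=
    fun k s hs h => (hTM₀ k s hs h).trans (by
      gcongr
      exact (Finset.single_le_sum (fun k _ => (hM₀ k).le) (Finset.mem_univ k)).trans (by linarith))
  have hTx : ∀ k n, ∀ s ∈ Set.Icc (1 / 2 : ℝ) 3, ‖(T k).opR s (x k n)‖ ≤ M := fun k n s hs => by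
    simpa [(hx k).norm_eq] using hTM k s hs (x k n)
  let A : ℕ → ℝ → H j →L[ℂ] HilbertTensor H := fun n => slot R T (fun k => x k n) j
  set ρ := ‖(R : HilbertTensor H →L[ℂ] HilbertTensor H)‖
  set C := ρ * M ^ (Finset.univ.erase j).card
  have hC0 : 0 ≤ C := by positivity
  have hcont : ∀ n h, ContinuousOn (fun s => A n s h) (Set.Ioi 0) := fun n h =>
    continuousOn_slot hT h
  have hbd : ∀ n, ∀ s ∈ Set.Icc (1 / 2 : ℝ) 3, ∀ h, ‖A n s h‖ ≤ C * ‖h‖ := fun n s hs h =>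
    norm_slot_le ((Finset.prod_le_prod (fun k _ => norm_nonneg _) fun k _ => hTx k n s hs).trans
      (by simp)) h
  have hτ : ((2⁻¹ : ℝ≥0) : ℝ) = 1 / 2 := by simp
  have hsub : ∀ u v : ℝ, 1 / 2 ≤ u → v ≤ 3 → Set.Ioo u v ⊆ Set.Icc (1 / 2) 3 :=
    fun u v hu hv s hs => ⟨hu.trans hs.1.le, hs.2.le.trans hv⟩
  have hsub0 : ∀ u v : ℝ, 1 / 2 ≤ u → Set.Ioo u v ⊆ Set.Ioi 0 :=
    fun u v hu s hs => lt_trans (by linarith) hs.1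
  have hform : ∀ n, IsHilbertForm fun h => ∫ s in (1 : ℝ)..2, ‖A n s h‖ ^ 2 := fun n =>
    isHilbertForm_intervalIntegral (A n) (by norm_num) hC0
      (fun h => (hcont n h).mono (hsub0 _ _ (by norm_num)))
      fun s hs => hbd n s (hsub _ _ (by norm_num) (by norm_num) hs)
  -- The approximate eigenvectors need not converge; only the averaged forms are needed in the
  -- limit, and being uniformly bounded they converge along an ultrafilter.
  let U : Ultrafilter ℕ := hyperfilter ℕ
  have hU : (U : Filter ℕ) ≤ atTop := Nat.hyperfilter_le_atTop
  obtain ⟨N, hN, hlim⟩ := exists_isHilbertForm_tendsto U _ (C ^ 2) hform fun n h => by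
    have := integral_norm_sq_le (f := fun s => A n s h) (a := 1) (b := 2) (C := C * ‖h‖)
      (by norm_num) ((hcont n h).mono (hsub0 _ _ (by norm_num)))
      fun s hs => hbd n s (hsub _ _ (by norm_num) (by norm_num) hs) h
    refine this.trans (le_of_eq ?_)
    ring
  -- The norm of T_k(3) x_k tends to |μ_k|³ = 1. Since T_k(3) = T_k(3-s) T_k(s) and 3-s stays in [1,
  -- 2], this bounds T_k(s) x_k below for s in (1, 2).
  have hlow : ∀ᶠ n in atTop, ∀ k, 1 / 2 ≤ ‖(T k).op 3 (x k n)‖ := by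
    refine eventually_all.2 fun k => ?_
    have h3 := ((hx k).pow 3).tendsto
    filter_upwards [h3.eventually (gt_mem_nhds (by norm_num : (0 : ℝ) < 1 / 2))] with n hn
    have hop : (T k).op 3 = (T k).op 1 ^ 3 := by
      rw [← op_natCast]
      norm_num
    have h4 := norm_sub_norm_le (μ k ^ 3 • x k n) (((T k).op 1 ^ 3) (x k n))
    rw [norm_sub_rev, norm_smul, norm_pow, hμ, one_pow, one_mul, (hx k).norm_eq] at h4
    rw [hop]
    linarith
  set c := (1 / (2 * M)) ^ (Finset.univ.erase j).card /
    (‖(R.symm : HilbertTensor H →L[ℂ] HilbertTensor H)‖ + 1)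
  have hc : 0 < c := by positivity
  have hcN : ∀ h, c ^ 2 * ‖h‖ ^ 2 ≤ N h := fun h => by
    refine ge_of_tendsto (hlim h) (hU ?_)
    filter_upwards [hlow] with n hn
    have := le_integral_norm_sq (f := fun s => A n s h) (a := 1) (b := 2) (c := c * ‖h‖)
      (by norm_num) (by positivity) ((hcont n h).mono (hsub0 _ _ (by norm_num)))
      (fun s hs => hbd n s (hsub _ _ (by norm_num) (by norm_num) hs) h) fun s hs => by
        refine le_norm_slot ?_ h
        rw [← Finset.prod_const]
        refine Finset.prod_le_prod (fun k _ => by positivity) fun k _ => ?_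
        have h5 := hTM k (3 - s) ⟨by linarith [hs.2], by linarith [hs.1]⟩ ((T k).opR s (x k n))
        rw [← opR_add _ (by linarith [hs.2]) (by linarith [hs.1]), sub_add_cancel] at h5
        have h6 : (T k).opR 3 = (T k).op 3 := by
          rw [← opR_coe]
          norm_num
        rw [h6] at h5
        rw [div_le_iff₀ (by positivity)]
        linarith [hn k]
    refine le_trans (le_of_eq ?_) this
    ring
  refine isSC_of_form hN (by positivity) hcN (τ := 2⁻¹) (by positivity) fun t _ ht h => ?_
  have ht' : (t : ℝ) ≤ 1 / 2 := by
    rw [← hτ]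
    exact_mod_cast ht
  have ht0 : (0 : ℝ) ≤ t := t.coe_nonneg
  let δ : ℕ → ℝ := fun n => M * ∑ k, ‖(T k).op 1 (x k n) - μ k • x k n‖
  have hδ : Tendsto δ atTop (𝓝 0) := by
    have := (tendsto_finsetSum Finset.univ fun k _ => (hx k).tendsto).const_mul M
    simpa using this
  let η : ℕ → ℝ := fun n =>
    ρ * (Fintype.card ι * (M + ‖h‖) ^ (Fintype.card ι - 1) * δ n) * (2 * (C * ‖h‖))
  have hη : Tendsto η atTop (𝓝 0) := by
    have := ((hδ.const_mul (Fintype.card ι * (M + ‖h‖) ^ (Fintype.card ι - 1))).const_mul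
      ρ).mul_const (2 * (C * ‖h‖))
    simpa using this
  -- Near-periodicity of the squares: a difference of squares is the small difference of norms times
  -- their bounded sum.
  have hwrap : ∀ n, ∀ s ∈ Set.Ioo (1 - (t : ℝ)) 1,
      ‖A n s h‖ ^ 2 ≤ ‖A n (s + 1) h‖ ^ 2 + η n := fun n s hs => by
    have hs1 : s ∈ Set.Icc (1 / 2 : ℝ) 3 := ⟨by linarith [hs.1], by linarith [hs.2]⟩
    have hs2 : s + 1 ∈ Set.Icc (1 / 2 : ℝ) 3 := ⟨by linarith [hs.1], by linarith [hs.2]⟩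
    have h7 := abs_norm_tprod_update_sub_le R hμ (p := fun k => (T k).opR s (x k n))
      (q := fun k => (T k).opR (s + 1) (x k n)) (M := M) (δ := δ n) (by positivity)
      (fun k => hTx k n s hs1) (fun k => hTx k n _ hs2) (fun k => by
        have h8 : (T k).opR 1 = (T k).op 1 := by
          rw [← opR_coe]
          norm_num
        rw [opR_add _ (by linarith [hs1.1]) zero_le_one, h8, ← map_smul, ← map_sub]
        refine (hTM k s hs1 _).trans ?_
        exact mul_le_mul_of_nonneg_left
          (Finset.single_le_sum (f := fun k => ‖(T k).op 1 (x k n) - μ k • x k n‖)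
            (fun k _ => norm_nonneg _) (Finset.mem_univ k)) hM.le) j h
    have h9 : ‖A n s h‖ - ‖A n (s + 1) h‖ ≤
        ρ * (Fintype.card ι * (M + ‖h‖) ^ (Fintype.card ι - 1) * δ n) := (le_abs_self _).trans h7
    have h10 := hbd n s hs1 h
    have h11 := hbd n (s + 1) hs2 h
    calc ‖A n s h‖ ^ 2 = ‖A n (s + 1) h‖ ^ 2 +
          (‖A n s h‖ - ‖A n (s + 1) h‖) * (‖A n s h‖ + ‖A n (s + 1) h‖) := by ring
      _ ≤ ‖A n (s + 1) h‖ ^ 2 + η n := by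
          gcongr
          exact mul_le_mul h9 (by linarith) (by positivity) (by positivity)
  have hstep : ∀ n, ∫ s in (1 : ℝ)..2, ‖A n s ((T j).op t h)‖ ^ 2 ≤
      (∫ s in (1 : ℝ)..2, ‖A n s h‖ ^ 2) + t * η n := fun n => by
    have h1 := integral_norm_sq_shift_le (T := T j) (A := A n) (a := 1) (b := 2) (τ := 2⁻¹) (C := C)
      (by norm_num) (fun h => (hcont n h).mono (hsub0 _ _ (by rw [hτ]; norm_num)))
      (fun s hs => hbd n s (hsub _ _ (by rw [hτ]; norm_num) (by norm_num) hs))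
      (fun t _ s hs h => norm_slot_shift_le hR (by
        rw [hτ] at hs
        linarith [hs.1]) t h) t ht h
    have hint : ∀ u v : ℝ, 1 / 2 ≤ u → u ≤ v → v ≤ 3 →
        IntervalIntegrable (fun s => ‖A n s h‖ ^ 2) volume u v := fun u v hu huv hv =>
      intervalIntegrable_norm_sq ((hcont n h).mono (hsub0 u v hu))
        (fun s hs => hbd n s (hsub u v hu hv hs) h) le_rfl huv le_rfl
    have h2 : ∫ s in (2 - (t : ℝ))..2, ‖A n s h‖ ^ 2 =
        ∫ s in (1 - (t : ℝ))..1, ‖A n (s + 1) h‖ ^ 2 := by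
      rw [intervalIntegral.integral_comp_add_right (fun s => ‖A n s h‖ ^ 2)]
      congr 1 <;> ring
    have hint' : IntervalIntegrable (fun s => ‖A n (s + 1) h‖ ^ 2) volume (1 - (t : ℝ)) 1 := by
      have := (hint (2 - t) 2 (by linarith) (by linarith) (by norm_num)).comp_add_right (1 : ℝ)
      convert this using 1 <;> ring
    have h3 := intervalIntegral.integral_mono_on_of_le_Ioo (by linarith : 1 - (t : ℝ) ≤ 1)
      (hint (1 - t) 1 (by linarith) (by linarith) (by norm_num))
      (hint'.add (intervalIntegrable_const (c := η n))) (hwrap n)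
    rw [intervalIntegral.integral_add hint' intervalIntegrable_const,
      intervalIntegral.integral_const, sub_sub_cancel, smul_eq_mul] at h3
    linarith
  refine le_of_tendsto_of_tendsto' (hlim _) ?_ hstep
  have := (hlim h).add ((hη.mono_left hU).const_mul (t : ℝ))
  simpa using this

end OpSemigroup

/-! ### Decay rates -/

namespace OpSemigroup

section DecayRates

variable {H : Type*} [NormedAddCommGroup H] [InnerProductSpace ℂ H]

/-- The exponents `d` such that `e_d T` is exponentially stable. -/
def decayRates (T : OpSemigroup H) : Set ℝ :=
  {d | ∃ n : ℕ, n ≠ 0 ∧ Real.exp (d * n) * ‖T.op n‖ < 1}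

theorem decayRates_nonempty (T : OpSemigroup H) : T.decayRates.Nonempty := by
  refine ⟨-‖T.op 1‖, 1, one_ne_zero, ?_⟩
  rw [Nat.cast_one, mul_one, Nat.cast_one, Real.exp_neg, inv_mul_lt_one₀ (Real.exp_pos _)]
  linarith [Real.add_one_le_exp ‖T.op 1‖]

theorem mem_decayRates_of_le {T : OpSemigroup H} {d e : ℝ} (hd : d ∈ T.decayRates) (he : e ≤ d) :
    e ∈ T.decayRates := by
  obtain ⟨n, hn, hlt⟩ := hd
  exact ⟨n, hn, lt_of_le_of_lt (by gcongr) hlt⟩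

theorem isOpen_decayRates (T : OpSemigroup H) : IsOpen T.decayRates := by
  have : T.decayRates = ⋃ n : ℕ, {d | n ≠ 0 ∧ Real.exp (d * n) * ‖T.op n‖ < 1} := by
    ext d
    simp [decayRates]
  rw [this]
  refine isOpen_iUnion fun n => ?_
  exact isOpen_const.and (isOpen_lt (f := fun d : ℝ => Real.exp (d * n) * ‖T.op n‖) (by fun_prop)
    continuous_const)

theorem mem_decayRates_of_lt_sSup {T : OpSemigroup H} {d : ℝ} (hd : d < sSup T.decayRates) :
    d ∈ T.decayRates := by
  obtain ⟨e, he, hde⟩ := exists_lt_of_lt_csSup T.decayRates_nonempty hd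
  exact mem_decayRates_of_le he hde.le

/-- The set of stable rates is open, so it cannot contain its supremum. -/
theorem sSup_notMem_decayRates {T : OpSemigroup H} (hb : BddAbove T.decayRates) :
    sSup T.decayRates ∉ T.decayRates := fun h => by
  obtain ⟨ε, hε, hball⟩ := Metric.isOpen_iff.1 T.isOpen_decayRates _ h
  have hmem : sSup T.decayRates + ε / 2 ∈ T.decayRates := hball (by
    rw [Metric.mem_ball, Real.dist_eq, add_sub_cancel_left, abs_of_pos (by positivity)]
    linarith)
  linarith [le_csSup hb hmem]

theorem isSC_rescale_of_mem_decayRates [CompleteSpace H] {T : OpSemigroup H}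
    (hT : T.StronglyContinuousOnIoi) (hQ : T.IsSQC) {d : ℝ} (hd : d ∈ T.decayRates) :
    (T.rescale d).IsSC := by
  obtain ⟨n, hn, hlt⟩ := hd
  refine isSC_of_isSQC_of_norm_lt_one (hT.rescale d) (hQ.rescale d) hn ?_
  rw [norm_rescale]
  exact_mod_cast hlt

end DecayRates

section Tensor

variable {ι : Type*} [Fintype ι] [DecidableEq ι] {H : ι → Type*} [∀ k, NormedAddCommGroup (H k)]
  [∀ k, InnerProductSpace ℂ (H k)] [∀ k, CompleteSpace (H k)]

theorem exists_isSC_rescale_of_isSC_tensor [Nonempty ι] {T : ∀ k, OpSemigroup (H k)}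
    (hT : ∀ k, (T k).StronglyContinuousOnIoi) (hT0 : ∀ k, (T k).IsNonzero)
    (hSC : (tensor T).IsSC) : ∃ d : ι → ℝ, ∑ k, d k = 0 ∧ ∀ k, ((T k).rescale (d k)).IsSC := by
  by_cases hd : ∃ d : ι → ℝ, ∑ k, d k = 0 ∧ ∀ k, d k ∈ (T k).decayRates
  · obtain ⟨d, hsum, hd⟩ := hd
    exact ⟨d, hsum, fun k =>
      isSC_rescale_of_mem_decayRates (hT k) (isSQC_of_isSC_tensor hT hT0 hSC k) (hd k)⟩
  -- If every rate were stable for one factor, that factor could balance arbitrary stable rates of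
  -- the others, against the failure of `hd`.
  have hbdd : ∀ j, BddAbove (T j).decayRates := by
    intro j
    by_contra hcon
    rw [not_bddAbove_iff] at hcon
    choose g hg using fun k => (T k).decayRates_nonempty
    refine hd ⟨Function.update g j (-∑ k ∈ Finset.univ.erase j, g k), ?_, fun k => ?_⟩
    · rw [← Finset.add_sum_erase _ _ (Finset.mem_univ j), Function.update_self,
        Finset.sum_congr rfl fun k hk => Function.update_of_ne (Finset.ne_of_mem_erase hk) _ _,
        neg_add_cancel]
    · rcases eq_or_ne k j with rfl | hk
      · rw [Function.update_self]
        obtain ⟨e, he, hlt⟩ := hcon (-∑ i ∈ Finset.univ.erase k, g i)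
        exact mem_decayRates_of_le he hlt.le
      · rw [Function.update_of_ne hk]
        exact hg k
  set δ : ι → ℝ := fun k => sSup (T k).decayRates
  have hle : ∑ k, δ k ≤ 0 := by
    by_contra! hpos
    have hcard : (0 : ℝ) < Fintype.card ι := by exact_mod_cast Fintype.card_pos
    refine hd ⟨fun k => δ k - (∑ i, δ i) / Fintype.card ι, ?_, fun k =>
      mem_decayRates_of_lt_sSup (sub_lt_self _ (by positivity))⟩
    rw [Finset.sum_sub_distrib, Finset.sum_const, Finset.card_univ, nsmul_eq_mul,
      mul_div_cancel₀ _ hcard.ne', sub_self]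
  have hone : ∀ k (n : ℕ), 1 ≤ ‖((T k).rescale (δ k)).op n‖ := by
    intro k n
    rcases eq_or_ne n 0 with rfl | hn
    · obtain ⟨t, -, ht⟩ := hT0 k
      have hnt : Nontrivial (H k) := by
        by_contra hcon
        rw [not_nontrivial_iff_subsingleton] at hcon
        exact ht (Subsingleton.elim _ _)
      rw [Nat.cast_zero, op_zero, norm_one]
    · by_contra! hlt
      rw [norm_rescale] at hlt
      exact sSup_notMem_decayRates (hbdd k) ⟨n, hn, by exact_mod_cast hlt⟩
  -- At integer times each rescaled factor has norm at least one, hence so has the product; a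
  -- negative sum would make the rescaled bounded tensor semigroup decay exponentially, which
  -- `prod_norm_le` forbids.
  have hge : 0 ≤ ∑ k, δ k := by
    by_contra! hneg
    obtain ⟨R, hR⟩ := isSC_iff.1 hSC
    set ρ := ‖(R.symm : HilbertTensor H →L[ℂ] HilbertTensor H)‖
    set ρ' := ‖(R : HilbertTensor H →L[ℂ] HilbertTensor H)‖
    have hbd : ∀ t, ‖(tensor T).op t‖ ≤ ρ * ρ' := fun t =>
      ContinuousLinearMap.opNorm_le_bound _ (by positivity) fun z => by
        calc ‖(tensor T).op t z‖
            = ‖(R.symm : HilbertTensor H →L[ℂ] HilbertTensor H) (R ((tensor T).op t z))‖ := by simp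
          _ ≤ ρ * (ρ' * ‖z‖) := ContinuousLinearMap.le_opNorm_of_le _
              ((hR t z).trans ((R : HilbertTensor H →L[ℂ] HilbertTensor H).le_opNorm z))
          _ = ρ * ρ' * ‖z‖ := by ring
    have hlim : Tendsto (fun n : ℕ => 2 ^ Fintype.card ι * (Real.exp (∑ k, δ k) ^ n * (ρ * ρ')))
        atTop (𝓝 (2 ^ Fintype.card ι * (0 * (ρ * ρ')))) :=
      ((tendsto_pow_atTop_nhds_zero_of_lt_one (Real.exp_pos _).le
        (by simpa using hneg)).mul_const _).const_mul _
    rw [zero_mul, mul_zero] at hlim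
    obtain ⟨n, hn⟩ := (hlim.eventually (gt_mem_nhds one_pos)).exists
    have h1 : (1 : ℝ) ≤ ∏ k, ‖((T k).rescale (δ k)).op n‖ := by
      calc (1 : ℝ) = ∏ _k : ι, 1 := by simp
        _ ≤ _ := Finset.prod_le_prod (fun _ _ => zero_le_one) fun k _ => hone k n
    have h2 : ‖(tensor fun k => (T k).rescale (δ k)).op n‖ ≤
        Real.exp (∑ k, δ k) ^ n * (ρ * ρ') := by
      rw [tensor_rescale, norm_rescale, ← Real.exp_nat_mul, mul_comm (n : ℝ)]
      have := hbd n
      push_cast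
      gcongr
    have h3 := HilbertTensor.prod_norm_le fun k => ((T k).rescale (δ k)).op n
    have h4 : (2 : ℝ) ^ Fintype.card ι * ‖(tensor fun k => (T k).rescale (δ k)).op n‖ ≤
        2 ^ Fintype.card ι * (Real.exp (∑ k, δ k) ^ n * (ρ * ρ')) := by gcongr
    exact absurd (h1.trans (h3.trans h4)) (not_le.2 hn)
  have hsum : ∑ k, δ k = 0 := le_antisymm hle hge
  have hap : ∀ k, ∃ μ x, ‖μ‖ = 1 ∧ IsApproxEigenvector (((T k).rescale (δ k)).op 1) μ x := by
    refine fun k => exists_isApproxEigenvector _ (fun n => ?_) fun d hd => ?_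
    · rw [← op_natCast]
      exact hone k n
    · obtain ⟨n, hn, hlt⟩ : d + δ k ∈ (T k).decayRates :=
        mem_decayRates_of_lt_sSup (add_lt_of_neg_left _ hd)
      refine ⟨n, hn, ?_⟩
      rw [← op_natCast, norm_rescale, ← mul_assoc, ← Real.exp_add]
      rw [add_mul] at hlt
      exact_mod_cast hlt
  choose μ x hμ hx using hap
  refine ⟨δ, hsum, isSC_of_isSC_tensor_of_isApproxEigenvector (fun k => (hT k).rescale _) ?_ hμ hx⟩
  rwa [tensor_rescale, hsum, rescale_zero]

end Tensor

end OpSemigroup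

end

theorem theorem1p1 {m : ℕ} (hm : 2 ≤ m) (H : Fin m → Type*)
    [∀ k, NormedAddCommGroup (H k)] [∀ k, InnerProductSpace ℂ (H k)] [∀ k, CompleteSpace (H k)]
    (T : ∀ k, OpSemigroup (H k)) (hT : ∀ k, (T k).StronglyContinuousOnIoi)
    (hT0 : ∀ k, (T k).IsNonzero) :
    ((OpSemigroup.tensor T).IsSQC ↔ ∀ k, (T k).IsSQC) ∧
      ((OpSemigroup.tensor T).IsSC ↔
        ∃ d : Fin m → ℝ, ∑ k, d k = 0 ∧ ∀ k, ((T k).rescale (d k)).IsSC) := by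
  have : Nonempty (Fin m) := ⟨⟨0, by omega⟩⟩
  refine ⟨⟨fun h k => ?_, fun h => ?_⟩, fun h => ?_, ?_⟩
  · obtain ⟨a, ha⟩ := OpSemigroup.isSQC_iff.1 h
    -- The whole rescaling is put on the factor under study and undone at the end.
    set d : Fin m → ℝ := Pi.single k a
    have hd : ∑ i, d i = a := by simp [d]
    rw [← hd, ← OpSemigroup.tensor_rescale] at ha
    have := OpSemigroup.isSQC_of_isSC_tensor (fun i => (hT i).rescale (d i))
      (fun i => (hT0 i).rescale (d i)) ha k
    simpa [OpSemigroup.rescale_rescale, OpSemigroup.rescale_zero] using this.rescale (-d k)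
  · choose a ha using fun k => OpSemigroup.isSQC_iff.1 (h k)
    refine OpSemigroup.isSQC_iff.2 ⟨∑ k, a k, ?_⟩
    rw [← OpSemigroup.tensor_rescale]
    exact OpSemigroup.isSC_tensor ha
  · exact OpSemigroup.exists_isSC_rescale_of_isSC_tensor hT hT0 h
  · rintro ⟨d, hsum, hd⟩
    have := OpSemigroup.isSC_tensor hd
    rwa [OpSemigroup.tensor_rescale, hsum, OpSemigroup.rescale_zero] at this
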